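/- Let $k\ge 1$, $N\ge k$, and let $f_1,\dots,f_N$ be affine forms on $\mathbb R^k$ with zero sets $H_j=\ker f_j$ and linear parts $l_j=f_j-f_j(0)$. Assume that the $H_j$ are in generic position: they are distinct, any $k$ of them meet at a single point, and any $k+1$ of them have empty intersection. Let $\alpha_1,\dots,\alpha_N>0$. Let $\mathcal X$ be the set of vertices of the arrangement; a vertex $X$ is regarded both as a $k$-element subset $\{j_1,\dots,j_k\}$ of $\{1,\dots,N\}$ and as the point $H_{j_1}\cap\dots\cap H_{j_k}$. Let $f_0$ be a linear form on $\mathbb R^k$ that takes distinct values at the vertices and is nonconstant on the intersection line of any $k-1$ of the hyperplanes. Let $\mathcal D^+$ be the set of connected components of $\mathbb R^k\setminus\bigcup_j H_j$ on which $f_0$ is bounded from below. Fix an orientation of $\mathbb R^k$, and for $X=\{j_1,\dots,j_k\}\in\mathcal X$ put $$\omega_X=\frac{df_{j_1}}{f_{j_1}}\wedge\dots\wedge\frac{df_{j_k}}{f_{j_k}},$$ where the elements of $X$ are ordered so that $df_{j_1}\wedge\dots\wedge df_{j_k}$ is positively oriented (if $k=1$, where there is only one ordering, $\omega_X=\pm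 df_{j_1}/f_{j_1}$ with the sign for which $\pm df_{j_1}$ is positively oriented). For $U\subset\{1,\dots,N\}$ with $|U|=k-1$, let $e_U$ be the vector directing the line $L_U=\bigcap_{j\in U}H_j$ (with $L_\emptyset=\mathbb R$ if $k=1$), normalized by $f_0(e_U)=1$. Then for every $\Delta\in\mathcal D^+$ and every $\lambda\in\mathbb C$ with $\operatorname{Re}\lambda>0$ the integrals $$I_{\Delta,X}(\lambda)=\int_\Delta e^{-\lambda f_0}\Big(\prod_{j=1}^N|f_j|^{\alpha_j}\Big)\,\omega_X,\qquad X\in\mathcal X,$$ converge absolutely, and the vector $I_\Delta(\lambda)=(I_{\Delta,X}(\lambda))_{X\in\mathcal X}$ is complex differentiable on $\{\operatorname{Re}\lambda>0\}$ and satisfies $$I_\Delta'=-\Big(\mathcal A+\frac1\lambda\mathcal B\Big)I_\Delta .$$ Here $\mathcal A$ is the diagonal matrix with $\mathcal A_{X,X}=f_0(X)$, and $\mathcal B$ is given by $\mathcal B_{X,X}=\sum_{j\in X}\alpha_j$; by $\mathcal B_{X,Y}=\operatorname{sgn}\big(l_j(e_U)\,l_r(e_U)\big)\,\alpha_r$ if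 $|X\cap Y|=k-1$, where $\{j\}=X\setminus Y$, $\{r\}=Y\setminus X$ and $U=X\cap Y$; and by $\mathcal B_{X,Y}=0$ if $|X\cap Y|<k-1$. -/

import Mathlib

open scoped BigOperators

noncomputable section

namespace HyperplaneIntegrals

/-- The space `ℝ^k`. -/
abbrev Space (k : ℕ) : Type := EuclideanSpace ℝ (Fin k)

/-- Vertices of a generic arrangement of `N` hyperplanes in `ℝ^k`, as `k`-element sets of indices. -/
abbrev Vertex (N k : ℕ) : Type := {X : Finset (Fin N) // X.card = k}

/-- The hyperplane `H_j = ker f_j`. -/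
def hyperplane {N k : ℕ} (f : Fin N → Space k →ᵃ[ℝ] ℝ) (j : Fin N) : Set (Space k) :=
  {z | f j z = 0}

/-- The intersection of the hyperplanes `H_j`, `j ∈ U`. -/
def flat {N k : ℕ} (f : Fin N → Space k →ᵃ[ℝ] ℝ) (U : Finset (Fin N)) : Set (Space k) :=
  {z | ∀ j ∈ U, z ∈ hyperplane f j}

/-- The hyperplanes are in generic position: they are distinct, any `k` of them meet at a
single point and any `k + 1` of them have empty intersection. -/
structure IsGeneric {N k : ℕ} (f : Fin N → Space k →ᵃ[ℝ] ℝ) : Prop where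
  distinct : Function.Injective (hyperplane f)
  vertex : ∀ X : Finset (Fin N), X.card = k → ∃ z, flat f X = {z}
  empty : ∀ S : Finset (Fin N), S.card = k + 1 → flat f S = ∅

/-- The vertex `X`, as the point of `ℝ^k` that is the intersection of the `H_j`, `j ∈ X`. -/
def vertexPoint {N k : ℕ} (f : Fin N → Space k →ᵃ[ℝ] ℝ) (X : Vertex N k) : Space k :=
  Classical.epsilon fun z => flat f X.1 = {z}

/-- The linear form `f₀` is in general position with respect to the arrangement: it takes
distinct values at the vertices and is nonconstant on the intersection of any `k - 1` of the
hyperplanes. -/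
structure IsGenericForm {N k : ℕ} (f : Fin N → Space k →ᵃ[ℝ] ℝ) (f₀ : Space k →ₗ[ℝ] ℝ) :
    Prop where
  distinct : Function.Injective fun X : Vertex N k => f₀ (vertexPoint f X)
  nonconstant : ∀ U : Finset (Fin N), U.card + 1 = k →
    ∃ z ∈ flat f U, ∃ w ∈ flat f U, f₀ z ≠ f₀ w

/-- The complement of the union of the hyperplanes. -/
def arrangementCompl {N k : ℕ} (f : Fin N → Space k →ᵃ[ℝ] ℝ) : Set (Space k) :=
  (⋃ j, hyperplane f j)ᶜ

/-- The arrangement domains: connected components of the complement of the hyperplanes. -/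
def domains {N k : ℕ} (f : Fin N → Space k →ᵃ[ℝ] ℝ) : Set (Set (Space k)) :=
  {Δ | ∃ x ∈ arrangementCompl f, Δ = connectedComponentIn (arrangementCompl f) x}

/-- The arrangement domains on which `f₀` is bounded from below. -/
def domainsPlus {N k : ℕ} (f : Fin N → Space k →ᵃ[ℝ] ℝ) (f₀ : Space k →ₗ[ℝ] ℝ) :
    Set (Set (Space k)) :=
  {Δ | Δ ∈ domains f ∧ BddBelow (f₀ '' Δ)}

/-- The exterior product `φ₁ ∧ ⋯ ∧ φ_k`, that is `(v₁, …, v_k) ↦ det (φ_j (v_i))`. -/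
def wedge {k : ℕ} (φ : Fin k → Space k →ₗ[ℝ] ℝ) : Space k [⋀^Fin k]→ₗ[ℝ] ℝ :=
  (Matrix.detRowAlternating (n := Fin k) (R := ℝ)).compLinearMap (LinearMap.pi φ)

open Classical in
/-- The coefficient of a `k`-form with respect to the Euclidean volume form of the oriented
space `(ℝ^k, o)`: its value on the standard basis, with a minus sign if the standard basis is
negatively oriented. The form is positively oriented when this is positive. -/
def orientedCoeff {k : ℕ} (o : Orientation ℝ (Space k) (Fin k))
    (η : Space k [⋀^Fin k]→ₗ[ℝ] ℝ) : ℝ :=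
  (if (EuclideanSpace.basisFun (Fin k) ℝ).toBasis.orientation = o then 1 else -1) *
    η (EuclideanSpace.basisFun (Fin k) ℝ)

open Classical in
/-- The one of the two forms `η`, `-η` that is positively oriented (if `η ≠ 0`). -/
def posOriented {k : ℕ} (o : Orientation ℝ (Space k) (Fin k))
    (η : Space k [⋀^Fin k]→ₗ[ℝ] ℝ) : Space k [⋀^Fin k]→ₗ[ℝ] ℝ :=
  if 0 < orientedCoeff o η then η else -η

/-- The form `ω_X = df_{j₁}/f_{j₁} ∧ ⋯ ∧ df_{j_k}/f_{j_k}` at the point `z`, with the sign for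
which `df_{j₁} ∧ ⋯ ∧ df_{j_k}` is positively oriented. By `vertexForm_eq`, this is the form
obtained from any ordering of `X` for which `df_{j₁} ∧ ⋯ ∧ df_{j_k}` is positively oriented. -/
def vertexForm {N k : ℕ} (o : Orientation ℝ (Space k) (Fin k)) (f : Fin N → Space k →ᵃ[ℝ] ℝ)
    (X : Vertex N k) (z : Space k) : Space k [⋀^Fin k]→ₗ[ℝ] ℝ :=
  (∏ j ∈ X.1, f j z)⁻¹ • posOriented o (wedge fun i => (f (X.1.orderEmbOfFin X.2 i)).linear)

theorem wedge_perm {k : ℕ} (φ : Fin k → Space k →ₗ[ℝ] ℝ) (σ : Equiv.Perm (Fin k)) :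
    wedge (fun i => φ (σ i)) = (((Equiv.Perm.sign σ : ℤˣ) : ℤ) : ℝ) • wedge φ := by
  ext v
  exact Matrix.det_permute' σ (Matrix.of fun i j => φ j (v i))

theorem orientedCoeff_neg {k : ℕ} (o : Orientation ℝ (Space k) (Fin k))
    (η : Space k [⋀^Fin k]→ₗ[ℝ] ℝ) : orientedCoeff o (-η) = -orientedCoeff o η := by
  simp [orientedCoeff]

theorem vertexForm_eq {N k : ℕ} (o : Orientation ℝ (Space k) (Fin k))
    (f : Fin N → Space k →ᵃ[ℝ] ℝ) (X : Vertex N k) (z : Space k) (e : Fin k ≃ X.1)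
    (he : 0 < orientedCoeff o (wedge fun i => (f (e i)).linear)) :
    vertexForm o f X z = (∏ j ∈ X.1, f j z)⁻¹ • wedge fun i => (f (e i)).linear := by
  unfold vertexForm
  congr 1
  set e₀ : Fin k ≃ X.1 := (X.1.orderIsoOfFin X.2).toEquiv
  have h := wedge_perm (fun i => (f (e₀ i)).linear) (e.trans e₀.symm)
  simp only [Equiv.trans_apply, Equiv.apply_symm_apply] at h
  have h₀ : (fun i => (f (X.1.orderEmbOfFin X.2 i)).linear) = fun i => (f (e₀ i)).linear := rfl
  rw [h₀]
  rw [h] at he ⊢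
  rcases Int.units_eq_one_or (Equiv.Perm.sign (e.trans e₀.symm)) with hs | hs
  · simp only [hs, Units.val_one, Int.cast_one, one_smul] at he ⊢
    simp [posOriented, he]
  · have hn : ∀ η : Space k [⋀^Fin k]→ₗ[ℝ] ℝ, (-1 : ℝ) • η = -η := by
      intro η
      ext v
      simp
    simp only [hs, Units.val_neg, Units.val_one, Int.cast_neg, Int.cast_one, hn] at he ⊢
    rw [orientedCoeff_neg] at he
    rw [posOriented, if_neg (by linarith)]

/-- The coefficient of `e^{-λ f₀} Ω_X`, `Ω_X = (∏ |f_j|^{α_j}) ω_X`, with respect to the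
volume form of `(ℝ^k, o)`. -/
def integrand {N k : ℕ} (o : Orientation ℝ (Space k) (Fin k)) (f : Fin N → Space k →ᵃ[ℝ] ℝ)
    (f₀ : Space k →ₗ[ℝ] ℝ) (α : Fin N → ℝ) (X : Vertex N k) (lam : ℂ) (z : Space k) : ℂ :=
  Complex.exp (-lam * (f₀ z : ℂ)) *
    (((∏ j, |f j z| ^ α j) * orientedCoeff o (vertexForm o f X z) : ℝ) : ℂ)

/-- The vector `I_Δ(λ)` of the integrals `I_{Δ,X}(λ) = ∫_Δ e^{-λ f₀} Ω_X`. -/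
def integralVec {N k : ℕ} (o : Orientation ℝ (Space k) (Fin k)) (f : Fin N → Space k →ᵃ[ℝ] ℝ)
    (f₀ : Space k →ₗ[ℝ] ℝ) (α : Fin N → ℝ) (Δ : Set (Space k)) (lam : ℂ) : Vertex N k → ℂ :=
  fun X => ∫ z in Δ, integrand o f f₀ α X lam z

/-- The vector `e_U` directing the line `L_U`, normalized by `f₀(e_U) = 1`. -/
def edgeVector {N k : ℕ} (f : Fin N → Space k →ᵃ[ℝ] ℝ) (f₀ : Space k →ₗ[ℝ] ℝ)
    (U : Finset (Fin N)) : Space k :=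
  Classical.epsilon fun e =>
    (∃ p, flat f U = Set.range fun t : ℝ => p + t • e) ∧ f₀ e = 1

/-- The relative orientation `ε(j,r,U) = sgn (l_j(e_U) l_r(e_U))`. -/
def relSign {N k : ℕ} (f : Fin N → Space k →ᵃ[ℝ] ℝ) (f₀ : Space k →ₗ[ℝ] ℝ)
    (j r : Fin N) (U : Finset (Fin N)) : ℝ :=
  Real.sign ((f j).linear (edgeVector f f₀ U) * (f r).linear (edgeVector f f₀ U))

/-- The diagonal matrix with entries `f₀(X)`. -/
def matA {N k : ℕ} (f : Fin N → Space k →ᵃ[ℝ] ℝ) (f₀ : Space k →ₗ[ℝ] ℝ) :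
    Matrix (Vertex N k) (Vertex N k) ℝ :=
  Matrix.diagonal fun X => f₀ (vertexPoint f X)

/-- The matrix `B`. When `|X ∩ Y| = k - 1`, both sums run over one-element sets
`X \ Y = {j}` and `Y \ X = {r}`. -/
def matB {N k : ℕ} (f : Fin N → Space k →ᵃ[ℝ] ℝ) (f₀ : Space k →ₗ[ℝ] ℝ) (α : Fin N → ℝ) :
    Matrix (Vertex N k) (Vertex N k) ℝ :=
  Matrix.of fun X Y =>
    if X = Y then ∑ j ∈ X.1, α j
    else if (X.1 ∩ Y.1).card + 1 = k then
      ∑ j ∈ X.1 \ Y.1, ∑ r ∈ Y.1 \ X.1, relSign f f₀ j r (X.1 ∩ Y.1) * α r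
    else 0

end HyperplaneIntegrals

end

noncomputable section

namespace HyperplaneIntegrals

open MeasureTheory

/-! A domain Δ is an open polyhedron on which every `g j = s j • f j`, with signs `s j = ±1`, is
positive. Up to the constant `volCoeff f X * ∏ j ∈ X, s j`, the integral attached to X is that of
e^{-λ f₀} times the product of the `g j ^ α j`, with the exponents for j ∈ X lowered by one.

Differentiation in λ multiplies the integrand by -f₀. The edge vectors at X form a basis dual, up to
scaling, to the forms l_j with j ∈ X. Since f₀ equals 1 on each of them, f₀ - f₀(X) = ∑_{j ∈ X} f_j
/ l_j(e_U) with U = X \ {j} (`form_eq_sum`). The factor f_j cancels one pole, so only the exponents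
in U remain lowered. Such an integral is treated by integration by parts along e_U
(`integral_expWeight_lowered`): f₀ has derivative 1, the forms in U are constant, and no boundary
term appears because the remaining exponents are positive. This expresses λ times the integral
through the vertices U ∪ {r}, r ∉ U. Comparing determinants (`volCoeff_insert`) turns
l_r(e_U)/l_j(e_U) into its sign. The terms r = j form the diagonal of B, the others its off-diagonal
part.

Convergence and differentiation under the integral rest on the linear growth of f₀ on Δ
(`exists_growth`). The exponential then splits into decaying factors in the separate `g j`, and k of
these forms serve as affine coordinates. The growth holds because f₀ is positive on nonzero
recession directions of Δ (`recession_eq_zero`). -/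

/-! ### Linear algebra of generic arrangements: vertices, edges, edge vectors -/

/-- The open polyhedron on which all the affine forms `g j` are positive. -/
def polyhedron {N k : ℕ} (g : Fin N → Space k →ᵃ[ℝ] ℝ) : Set (Space k) :=
  {z | ∀ j, 0 < g j z}

/-- Any `k` of the linear parts have trivial common kernel. -/
def LinGeneric {N k : ℕ} (g : Fin N → Space k →ᵃ[ℝ] ℝ) : Prop :=
  ∀ X : Finset (Fin N), X.card = k → ∀ v, (∀ j ∈ X, (g j).linear v = 0) → v = 0

theorem affine_add_smul {k : ℕ} (g : Space k →ᵃ[ℝ] ℝ) (z v : Space k) (t : ℝ) :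
    g (z + t • v) = g z + t * g.linear v := by
  have := g.map_vadd z (t • v)
  simp only [vadd_eq_add, map_smul, smul_eq_mul] at this
  rw [add_comm z, this, add_comm]

theorem affine_eq_linear_add {k : ℕ} (g : Space k →ᵃ[ℝ] ℝ) (z : Space k) :
    g z = g 0 + g.linear z := by
  simpa using affine_add_smul g 0 z 1

theorem affine_sub {k : ℕ} (g : Space k →ᵃ[ℝ] ℝ) (z w : Space k) :
    g.linear (z - w) = g z - g w := by
  rw [map_sub, affine_eq_linear_add g z, affine_eq_linear_add g w]; ring

theorem affine_continuous {k : ℕ} (g : Space k →ᵃ[ℝ] ℝ) : Continuous g :=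
  g.continuous_of_finiteDimensional

theorem isOpen_polyhedron {N k : ℕ} (g : Fin N → Space k →ᵃ[ℝ] ℝ) : IsOpen (polyhedron g) := by
  have : polyhedron g = ⋂ j, {z | 0 < g j z} := by ext; simp [polyhedron]
  rw [this]
  exact isOpen_iInter_of_finite fun j => isOpen_lt continuous_const (affine_continuous _)

theorem IsGeneric.linGeneric {N k : ℕ} {f : Fin N → Space k →ᵃ[ℝ] ℝ} (hf : IsGeneric f) :
    LinGeneric f := by
  intro X hX v hv
  obtain ⟨z, hz⟩ := hf.vertex X hX
  have h1 : z ∈ flat f X := by rw [hz]; rfl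
  have h2 : z + (1 : ℝ) • v ∈ flat f X := by
    intro j hj
    have := h1 j hj
    simp only [hyperplane, Set.mem_ofPred_eq] at this ⊢
    rw [affine_add_smul, this, hv j hj]; simp
  rw [hz] at h2
  simpa using h2

theorem flat_vertexPoint {N k : ℕ} {f : Fin N → Space k →ᵃ[ℝ] ℝ} (hf : IsGeneric f)
    (X : Vertex N k) {j : Fin N} (hj : j ∈ X.1) : f j (vertexPoint f X) = 0 := by
  have h : flat f X.1 = {vertexPoint f X} := Classical.epsilon_spec (hf.vertex X.1 X.2)
  have : vertexPoint f X ∈ flat f X.1 := by rw [h]; rfl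
  exact this j hj

/-- Because |U| < N there is an index j outside U, and U ∪ {j} gives k forms with trivial common
kernel. A vector killed by U is therefore determined by its value under the form j. -/
theorem LinGeneric.line {N k : ℕ} {f : Fin N → Space k →ᵃ[ℝ] ℝ} (hf : LinGeneric f)
    (hN : k ≤ N) {U : Finset (Fin N)} (hU : U.card + 1 = k) {e v : Space k}
    (he : ∀ j ∈ U, (f j).linear e = 0) (he0 : e ≠ 0) (hv : ∀ j ∈ U, (f j).linear v = 0) :
    ∃ t : ℝ, v = t • e := by
  obtain ⟨j, hj⟩ : ∃ j, j ∉ U := by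
    by_contra! h
    have : U = Finset.univ := Finset.eq_univ_of_forall h
    rw [this, Finset.card_univ, Fintype.card_fin] at hU
    omega
  have hc : (insert j U).card = k := by rw [Finset.card_insert_of_notMem hj, hU]
  have hne : (f j).linear e ≠ 0 := fun h => he0 (hf _ hc e (by simpa using ⟨h, he⟩))
  refine ⟨(f j).linear v / (f j).linear e, sub_eq_zero.1 (hf _ hc _ ?_)⟩
  intro i hi
  rcases Finset.mem_insert.1 hi with rfl | hi
  · simp [div_mul_cancel₀ _ hne]
  · simp [he i hi, hv i hi]

/-- Shows that the choice defining `edgeVector` is not vacuous: the difference of two points of L_U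
on which f₀ differs can be rescaled to have f₀-value 1. -/
theorem edgeVector_spec {N k : ℕ} {f : Fin N → Space k →ᵃ[ℝ] ℝ} (hf : IsGeneric f) (hN : k ≤ N)
    {f₀ : Space k →ₗ[ℝ] ℝ} (hf₀ : IsGenericForm f f₀) {U : Finset (Fin N)}
    (hU : U.card + 1 = k) :
    (∀ j ∈ U, (f j).linear (edgeVector f f₀ U) = 0) ∧ f₀ (edgeVector f f₀ U) = 1 := by
  obtain ⟨z, hz, w, hw, hzw⟩ := hf₀.nonconstant U hU
  have hne : f₀ (w - z) ≠ 0 := by rw [map_sub]; exact sub_ne_zero.2 hzw.symm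
  have hl : ∀ j ∈ U, (f j).linear (w - z) = 0 := fun j hj => by
    have h1 := hz j hj
    have h2 := hw j hj
    simp only [hyperplane, Set.mem_ofPred_eq] at h1 h2
    rw [affine_sub, h1, h2, sub_zero]
  have key : ∃ e, (∃ p, flat f U = Set.range fun t : ℝ => p + t • e) ∧ f₀ e = 1 := by
    refine ⟨(f₀ (w - z))⁻¹ • (w - z), ⟨z, ?_⟩, ?_⟩
    · have he : ∀ j ∈ U, (f j).linear ((f₀ (w - z))⁻¹ • (w - z)) = 0 := fun j hj => by
        rw [map_smul, hl j hj, smul_zero]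
      ext x
      constructor
      · intro hx
        obtain ⟨t, ht⟩ := hf.linGeneric.line hN hU he
          (smul_ne_zero (inv_ne_zero hne) fun h => hne (by rw [h, map_zero])) (v := x - z) (by
            intro j hj
            have h1 := hz j hj
            have h2 := hx j hj
            simp only [hyperplane, Set.mem_ofPred_eq] at h1 h2
            rw [affine_sub, h1, h2, sub_zero])
        exact ⟨t, by simp only [← ht]; abel⟩
      · rintro ⟨t, rfl⟩ j hj
        have h1 := hz j hj
        simp only [hyperplane, Set.mem_ofPred_eq] at h1 ⊢
        rw [affine_add_smul, h1, he j hj]; simp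
    · rw [map_smul, smul_eq_mul, inv_mul_cancel₀ hne]
  obtain ⟨⟨p, hp⟩, h1⟩ := Classical.epsilon_spec key
  refine ⟨fun j hj => ?_, h1⟩
  have hp0 : p ∈ flat f U := by rw [hp]; exact ⟨0, by simp⟩
  have hp1 : p + (1 : ℝ) • edgeVector f f₀ U ∈ flat f U := by rw [hp]; exact ⟨1, rfl⟩
  have h1 := hp0 j hj
  have h2 := hp1 j hj
  simp only [hyperplane, Set.mem_ofPred_eq] at h1 h2
  rw [affine_add_smul, h1] at h2
  simpa using h2

theorem linear_edgeVector_ne_zero {N k : ℕ} {f : Fin N → Space k →ᵃ[ℝ] ℝ} (hf : IsGeneric f)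
    (hN : k ≤ N) {f₀ : Space k →ₗ[ℝ] ℝ} (hf₀ : IsGenericForm f f₀) {U : Finset (Fin N)}
    (hU : U.card + 1 = k) {r : Fin N} (hr : r ∉ U) :
    (f r).linear (edgeVector f f₀ U) ≠ 0 := by
  intro h
  obtain ⟨h1, h2⟩ := edgeVector_spec hf hN hf₀ hU
  have := hf.linGeneric (insert r U) (by rw [Finset.card_insert_of_notMem hr, hU])
    (edgeVector f f₀ U) (by simpa using ⟨h, h1⟩)
  rw [this, map_zero] at h2
  exact zero_ne_one h2

/-! ### Arrangement domains as polyhedra -/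

/-- Each `f j` keeps its sign on a connected set avoiding its zero set, which gives one inclusion.
Conversely, the polyhedron with these signs is convex, hence connected, and avoids all the
hyperplanes. -/
theorem exists_sign_of_mem_domains {N k : ℕ} {f : Fin N → Space k →ᵃ[ℝ] ℝ} {Δ : Set (Space k)}
    (hΔ : Δ ∈ domains f) :
    ∃ s : Fin N → ℝ, (∀ j, s j * s j = 1) ∧ Δ = polyhedron (fun j => s j • f j) ∧ Δ.Nonempty := by
  obtain ⟨x, hx, rfl⟩ := hΔ
  have hx' : ∀ j, f j x ≠ 0 := by
    simpa [arrangementCompl, hyperplane] using hx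
  refine ⟨fun j => SignType.sign (f j x), fun j => ?_, ?_, ⟨x, mem_connectedComponentIn hx⟩⟩
  · rcases lt_or_gt_of_ne (hx' j) with h | h
    · simp [sign_neg h]
    · simp [sign_pos h]
  have hmem : ∀ z, z ∈ polyhedron (fun j => ((SignType.sign (f j x) : SignType) : ℝ) • f j) ↔
      ∀ j, 0 < ((SignType.sign (f j x) : SignType) : ℝ) * f j z := fun z => Iff.rfl
  apply Set.Subset.antisymm
  · intro y hy
    rw [hmem]
    intro j
    have hc : IsPreconnected (f j '' connectedComponentIn (arrangementCompl f) x) :=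
      isPreconnected_connectedComponentIn.image _ (affine_continuous _).continuousOn
    have h0 : (0 : ℝ) ∉ f j '' connectedComponentIn (arrangementCompl f) x := by
      rintro ⟨w, hw, hw0⟩
      have := connectedComponentIn_subset _ _ hw
      exact this (Set.mem_iUnion.2 ⟨j, hw0⟩)
    have hxi : f j x ∈ f j '' connectedComponentIn (arrangementCompl f) x :=
      ⟨x, mem_connectedComponentIn hx, rfl⟩
    have hyi : f j y ∈ f j '' connectedComponentIn (arrangementCompl f) x := ⟨y, hy, rfl⟩
    rcases lt_or_gt_of_ne (hx' j) with h | h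
    · rw [sign_neg h]
      have : f j y < 0 := by
        by_contra! hcon
        exact h0 (hc.ordConnected.out hxi hyi ⟨h.le, hcon⟩)
      simpa using this
    · rw [sign_pos h]
      have : 0 < f j y := by
        by_contra! hcon
        exact h0 (hc.ordConnected.out hyi hxi ⟨hcon, h.le⟩)
      simpa using this
  · refine IsPreconnected.subset_connectedComponentIn (Convex.isPreconnected ?_) ?_ ?_
    · intro y hy z hz a b ha hb hab
      rw [hmem] at hy hz ⊢
      intro j
      have : f j (a • y + b • z) = a * f j y + b * f j z := by
        rw [affine_eq_linear_add (f j) y, affine_eq_linear_add (f j) z,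
          affine_eq_linear_add (f j) (a • y + b • z)]
        simp only [map_add, map_smul, smul_eq_mul]
        linear_combination (-(f j 0)) * hab
      rw [this]
      have h1 := hy j
      have h2 := hz j
      rcases ha.eq_or_lt with rfl | ha
      · rw [zero_add] at hab; subst hab; simpa using h2
      · have := mul_pos ha h1
        have := mul_nonneg hb h2.le
        linarith
    · rw [hmem]
      intro j
      rcases lt_or_gt_of_ne (hx' j) with h | h
      · simpa [sign_neg h] using h
      · simpa [sign_pos h] using h
    · intro z hz
      rw [hmem] at hz
      simp only [arrangementCompl, hyperplane, Set.mem_compl_iff, Set.mem_iUnion, not_exists,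
        Set.mem_ofPred_eq]
      intro j h
      have := hz j
      rw [h] at this
      simp at this

/-! ### Recession cone and linear growth of f₀ -/

theorem exists_ne_zero_of_card_lt {N k : ℕ} (g : Fin N → Space k →ᵃ[ℝ] ℝ) {S : Finset (Fin N)}
    (hS : S.card < k) : ∃ w : Space k, w ≠ 0 ∧ ∀ j ∈ S, (g j).linear w = 0 := by
  have h := LinearMap.ker_ne_bot_of_finrank_lt
    (f := (LinearMap.pi fun j : S => (g j).linear : Space k →ₗ[ℝ] (S → ℝ))) (by simpa using hS)
  obtain ⟨w, hw, hw0⟩ := (Submodule.ne_bot_iff _).1 h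
  refine ⟨w, hw0, fun j hj => ?_⟩
  simpa using congrFun (LinearMap.mem_ker.1 hw) ⟨j, hj⟩

/-- A linear form that is nonnegative on the recession cone and nonzero on the edge directions
vanishes only at the apex. -/
theorem recession_eq_zero {N k : ℕ} {g : Fin N → Space k →ᵃ[ℝ] ℝ} (hg : LinGeneric g)
    (hN : k ≤ N) {f₀ : Space k →ₗ[ℝ] ℝ}
    (hedge : ∀ U : Finset (Fin N), U.card + 1 = k → ∀ v, (∀ j ∈ U, (g j).linear v = 0) →
      f₀ v = 0 → v = 0)
    (hpos : ∀ v, (∀ j, 0 ≤ (g j).linear v) → 0 ≤ f₀ v)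
    (v : Space k) (hv : ∀ j, 0 ≤ (g j).linear v) (hv0 : f₀ v ≤ 0) : v = 0 := by
  -- Induction on the number of constraints that are not tight at v. With at least k tight
  -- constraints v = 0 by genericity, and with k - 1 the vector lies along an edge. With fewer, v is
  -- moved until another constraint becomes tight.
  induction hn : (Finset.univ.filter fun j => (g j).linear v ≠ 0).card using
    Nat.strong_induction_on generalizing v with
  | _ n ih =>
  subst hn
  have hf0 : f₀ v = 0 := le_antisymm hv0 (hpos v hv)
  set U := Finset.univ.filter fun j => (g j).linear v = 0 with hUdef
  have hUv : ∀ j ∈ U, (g j).linear v = 0 := fun j hj => (Finset.mem_filter.1 hj).2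
  rcases lt_trichotomy (U.card + 1) k with h | h | h
  · obtain ⟨j₀, hj₀⟩ : ∃ j, j ∉ U := by
      by_contra! hcon
      have : U = Finset.univ := Finset.eq_univ_of_forall hcon
      rw [this, Finset.card_univ, Fintype.card_fin] at h
      omega
    obtain ⟨w, hw0, hw⟩ := exists_ne_zero_of_card_lt g
      (S := insert j₀ U) (by rwa [Finset.card_insert_of_notMem hj₀])
    have hwj₀ := hw j₀ (Finset.mem_insert_self _ _)
    have hwU : ∀ j ∈ U, (g j).linear w = 0 := fun j hj => hw j (Finset.mem_insert_of_mem hj)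
    have hvj₀ : (g j₀).linear v ≠ 0 := fun h => hj₀ (by simp [hUdef, h])
    -- Moving along w keeps the constraints in U tight and does not increase f₀. The new vector has
    -- fewer non-tight constraints, so it is zero by induction. Yet the form j₀ takes the same
    -- nonzero value on it as on v, a contradiction.
    have key : ∀ w : Space k, (∀ j ∈ U, (g j).linear w = 0) → (g j₀).linear w = 0 → f₀ w ≤ 0 →
        (∃ j, (g j).linear w < 0) → v = 0 := by
      intro w hwU hwj₀ hfw ⟨j₁, hj₁⟩
      obtain ⟨i, hi, hmin⟩ := Finset.exists_min_image
        (Finset.univ.filter fun j => (g j).linear w < 0)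
        (fun j => (g j).linear v / -(g j).linear w) ⟨j₁, by simpa using hj₁⟩
      have hi' : (g i).linear w < 0 := by simpa using hi
      -- The ratio test: the largest step for which all the linear parts stay nonnegative.
      set t := (g i).linear v / -(g i).linear w with ht
      have ht0 : 0 ≤ t := div_nonneg (hv i) (by linarith)
      have hnn : ∀ j, 0 ≤ (g j).linear (v + t • w) := by
        intro j
        rw [map_add, map_smul, smul_eq_mul]
        rcases lt_or_ge ((g j).linear w) 0 with hj | hj
        · have := hmin j (by simpa using hj)
          rw [le_div_iff₀ (by linarith)] at this
          linarith
        · have := hv j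
          positivity
      have hz : v + t • w = 0 := by
        refine ih _ (Finset.card_lt_card ?_) (v + t • w) hnn ?_ rfl
        · rw [Finset.ssubset_iff_of_subset]
          · refine ⟨i, ?_, ?_⟩
            · simp only [Finset.mem_filter, Finset.mem_univ, true_and]
              intro h
              exact hi'.ne (hwU i (by simp [hUdef, h]))
            · simp only [Finset.mem_filter, Finset.mem_univ, true_and, not_not]
              rw [map_add, map_smul, smul_eq_mul, ht]
              have := hi'.ne
              field_simp
              ring
          · intro j
            simp only [Finset.mem_filter, Finset.mem_univ, true_and]
            intro h h'
            apply h
            rw [map_add, map_smul, h', hwU j (by simp [hUdef, h'])]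
            simp
        · rw [map_add, map_smul, hf0, zero_add]
          exact mul_nonpos_of_nonneg_of_nonpos ht0 hfw
      have := congrArg (g j₀).linear hz
      rw [map_add, map_smul, hwj₀, map_zero] at this
      exact absurd (by simpa using this) hvj₀
    have hex : ∃ j, (g j).linear w ≠ 0 := by
      by_contra! hcon
      obtain ⟨X, -, hX⟩ := Finset.exists_subset_card_eq
        (s := (Finset.univ : Finset (Fin N))) (n := k) (by simpa using hN)
      exact hw0 (hg X hX w fun j _ => hcon j)
    -- If no linear part is negative on w, then f₀ w ≥ 0 by `hpos`, so -w also has f₀ ≤ 0 and can be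
    -- used instead.
    have key' : ∀ w : Space k, w ≠ 0 → (∀ j ∈ U, (g j).linear w = 0) → (g j₀).linear w = 0 →
        (∃ j, (g j).linear w ≠ 0) → f₀ w ≤ 0 → v = 0 := by
      intro w hw0 hwU hwj₀ ⟨i, hi⟩ hfw
      by_cases hneg : ∃ j, (g j).linear w < 0
      · exact key w hwU hwj₀ hfw hneg
      · push Not at hneg
        refine key (-w) (fun j hj => by simp [hwU j hj]) (by simp [hwj₀]) ?_ ⟨i, ?_⟩
        · have := hpos w hneg
          simpa using this
        · have := lt_of_le_of_ne (hneg i) hi.symm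
          simpa using this
    rcases le_total (f₀ w) 0 with hfw | hfw
    · exact key' w hw0 hwU hwj₀ hex hfw
    · exact key' (-w) (neg_ne_zero.2 hw0) (fun j hj => by simp [hwU j hj]) (by simp [hwj₀])
        (by simpa using hex) (by simpa using hfw)
  · exact hedge U h v hUv hf0
  · obtain ⟨X, hXU, hX⟩ := Finset.exists_subset_card_eq (s := U) (n := k) (by omega)
    exact hg X hX v fun j hj => hUv j (hXU hj)

/-- A compactness argument: a homogeneous penalty for leaving the recession cone or having f₀ > 0
vanishes only at the origin, so it dominates the norm. On the polyhedron it is at most f₀ plus a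
constant, and the `g j` grow at most linearly in the norm. -/
theorem exists_growth {N k : ℕ} {g : Fin N → Space k →ᵃ[ℝ] ℝ} (hg : LinGeneric g)
    (hN : k ≤ N) {f₀ : Space k →ₗ[ℝ] ℝ}
    (hedge : ∀ U : Finset (Fin N), U.card + 1 = k → ∀ v, (∀ j ∈ U, (g j).linear v = 0) →
      f₀ v = 0 → v = 0)
    (hne : (polyhedron g).Nonempty) (hb : BddBelow (f₀ '' polyhedron g)) :
    ∃ c K : ℝ, 0 < c ∧ ∀ z ∈ polyhedron g, c * ∑ j, g j z ≤ f₀ z + K := by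
  obtain ⟨m, hm⟩ := hb
  have hm' : ∀ z ∈ polyhedron g, m ≤ f₀ z := fun z hz => hm ⟨z, hz, rfl⟩
  obtain ⟨x, hx⟩ := hne
  have hpos : ∀ v, (∀ j, 0 ≤ (g j).linear v) → 0 ≤ f₀ v := by
    intro v hv
    by_contra! hneg
    -- Chosen so that f₀ (x + t v) = m - 1, below the lower bound m.
    set t := (f₀ x - m + 1) / -f₀ v with ht
    have hxm := hm' x hx
    have ht0 : 0 ≤ t := div_nonneg (by linarith) (by linarith)
    have := hm' (x + t • v) fun j => by
      rw [affine_add_smul]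
      have h1 := hx j
      have h2 := mul_nonneg ht0 (hv j)
      linarith
    rw [map_add, map_smul, smul_eq_mul, ht] at this
    have h3 : (f₀ x - m + 1) / -f₀ v * f₀ v = -(f₀ x - m + 1) := by
      field_simp [hneg.ne]
    linarith
  have hzero := recession_eq_zero hg hN hedge hpos
  set φ : Space k → ℝ := fun v => ∑ j, max (-((g j).linear v)) 0 + max (f₀ v) 0 with hφ
  have hφc : Continuous φ := by
    have h1 : ∀ j, Continuous (g j).linear := fun j =>
      LinearMap.continuous_of_finiteDimensional _
    have h2 : Continuous f₀ := LinearMap.continuous_of_finiteDimensional _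
    fun_prop
  have hφnn : ∀ v, 0 ≤ φ v := fun v =>
    add_nonneg (Finset.sum_nonneg fun j _ => le_max_right _ _) (le_max_right _ _)
  have hφpos : ∀ v, v ≠ 0 → 0 < φ v := by
    intro v hv
    refine lt_of_le_of_ne (hφnn v) fun h => hv (hzero v ?_ ?_)
    · have h1 : ∑ j, max (-((g j).linear v)) 0 = 0 :=
        le_antisymm (by have := le_max_right (f₀ v) 0; simp only [hφ] at h; linarith)
          (Finset.sum_nonneg fun j _ => le_max_right _ _)
      intro j
      have := (Finset.sum_eq_zero_iff_of_nonneg (fun j _ => le_max_right _ _)).1 h1 j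
        (Finset.mem_univ _)
      have := le_max_left (-((g j).linear v)) 0
      linarith
    · have h1 : 0 ≤ ∑ j, max (-((g j).linear v)) 0 :=
        Finset.sum_nonneg fun j _ => le_max_right _ _
      have := le_max_left (f₀ v) 0
      simp only [hφ] at h
      linarith
  obtain ⟨c, hc, hcφ⟩ : ∃ c : ℝ, 0 < c ∧ ∀ v, c * ‖v‖ ≤ φ v := by
    -- The sphere is empty exactly when k = 0, which is allowed here.
    rcases (Metric.sphere (0 : Space k) 1).eq_empty_or_nonempty with he | he
    · refine ⟨1, one_pos, fun v => ?_⟩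
      by_cases hv : v = 0
      · simpa [hv] using hφnn 0
      · have : ‖v‖⁻¹ • v ∈ Metric.sphere (0 : Space k) 1 := by
          simp [norm_smul, inv_mul_cancel₀ (norm_ne_zero_iff.2 hv)]
        rw [he] at this
        exact this.elim
    · obtain ⟨u, hu, hmin⟩ := (isCompact_sphere (0 : Space k) 1).exists_isMinOn he hφc.continuousOn
      have hu0 : u ≠ 0 := by
        rintro rfl
        simp at hu
      refine ⟨φ u, hφpos u hu0, fun v => ?_⟩
      by_cases hv : v = 0
      · simpa [hv] using hφnn 0
      · have hvn : 0 < ‖v‖ := norm_pos_iff.2 hv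
        have h1 : ‖v‖⁻¹ • v ∈ Metric.sphere (0 : Space k) 1 := by
          simp [norm_smul, inv_mul_cancel₀ (norm_ne_zero_iff.2 hv)]
        have h2 : φ u ≤ φ (‖v‖⁻¹ • v) := hmin h1
        have h3 : φ (‖v‖⁻¹ • v) = ‖v‖⁻¹ * φ v := by
          have hi : 0 ≤ ‖v‖⁻¹ := inv_nonneg.2 hvn.le
          simp only [hφ, map_smul, smul_eq_mul, mul_add, Finset.mul_sum,
            mul_max_of_nonneg _ _ hi, mul_zero, mul_neg]
        rw [h3] at h2
        calc φ u * ‖v‖ ≤ ‖v‖⁻¹ * φ v * ‖v‖ := by gcongr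
          _ = φ v := by field_simp
  set A := ∑ j, |g j 0| with hA
  set B := ∑ j, ‖LinearMap.toContinuousLinearMap (g j).linear‖ + 1 with hB
  have hBpos : 0 < B := by
    have : 0 ≤ ∑ j, ‖LinearMap.toContinuousLinearMap (g j).linear‖ :=
      Finset.sum_nonneg fun j _ => norm_nonneg _
    linarith
  refine ⟨c / B, A + |m| + c / B * A, div_pos hc hBpos, fun z hz => ?_⟩
  have h1 : φ z ≤ A + (f₀ z + |m|) := by
    refine add_le_add (Finset.sum_le_sum fun j _ => ?_) ?_
    · have h := hz j
      rw [affine_eq_linear_add] at h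
      exact max_le (by have := le_abs_self (g j 0); linarith) (abs_nonneg _)
    · have := hm' z hz
      exact max_le (by have := abs_nonneg m; linarith) (by have := neg_abs_le m; linarith)
  have h2 : ∑ j, g j z ≤ A + B * ‖z‖ := by
    have : ∑ j, g j z ≤ ∑ j, (|g j 0| + ‖LinearMap.toContinuousLinearMap (g j).linear‖ * ‖z‖) := by
      refine Finset.sum_le_sum fun j _ => ?_
      rw [affine_eq_linear_add]
      exact add_le_add (le_abs_self _) ((le_abs_self _).trans
        ((LinearMap.toContinuousLinearMap (g j).linear).le_opNorm z))
    rw [Finset.sum_add_distrib, ← Finset.sum_mul] at this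
    have := norm_nonneg z
    rw [hB, add_mul]
    linarith
  have h3 := hcφ z
  have h4 : c / B * ∑ j, g j z ≤ c / B * (A + B * ‖z‖) := by
    have := (div_pos hc hBpos).le
    gcongr
  have h5 : c / B * (A + B * ‖z‖) = c / B * A + c * ‖z‖ := by field_simp
  linarith

/-! ### Weighted integrals: convergence and differentiation in λ -/

/-- The product of the powers `(g j z) ^ (β j)`. -/
def weight {N k : ℕ} (g : Fin N → Space k →ᵃ[ℝ] ℝ) (β : Fin N → ℝ) (z : Space k) : ℝ :=
  ∏ j, g j z ^ β j

theorem measurable_weight {N k : ℕ} (g : Fin N → Space k →ᵃ[ℝ] ℝ) (β : Fin N → ℝ) :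
    Measurable (weight g β) :=
  Finset.measurable_prod _ fun j _ => (affine_continuous (g j)).measurable.pow_const _

theorem weight_pos {N k : ℕ} {g : Fin N → Space k →ᵃ[ℝ] ℝ} (β : Fin N → ℝ) {z : Space k}
    (hz : z ∈ polyhedron g) : 0 < weight g β z :=
  Finset.prod_pos fun j _ => Real.rpow_pos_of_pos (hz j) _

theorem exists_rpow_mul_exp_le {β δ : ℝ} (hβ : 0 ≤ β) (hδ : 0 < δ) :
    ∃ C : ℝ, 0 ≤ C ∧ ∀ t : ℝ, 0 < t → t ^ β * Real.exp (-δ * t) ≤ C := by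
  rcases hβ.eq_or_lt with rfl | hβ
  · refine ⟨1, zero_le_one, fun t ht => ?_⟩
    rw [Real.rpow_zero, one_mul, Real.exp_le_one_iff]
    nlinarith
  · refine ⟨(β / δ) ^ β, by positivity, fun t ht => ?_⟩
    have h1 : δ * t / β ≤ Real.exp (δ * t / β) := by
      have := Real.add_one_le_exp (δ * t / β)
      linarith
    have h2 : t ≤ β / δ * Real.exp (δ * t / β) := by
      calc t = β / δ * (δ * t / β) := by field_simp
        _ ≤ _ := by gcongr
    have h3 : t ^ β ≤ (β / δ) ^ β * Real.exp (δ * t) := by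
      refine (Real.rpow_le_rpow ht.le h2 hβ.le).trans_eq ?_
      rw [Real.mul_rpow (by positivity) (Real.exp_pos _).le, ← Real.exp_mul]
      congr 2
      field_simp
    calc t ^ β * Real.exp (-δ * t) ≤ (β / δ) ^ β * Real.exp (δ * t) * Real.exp (-δ * t) := by
          gcongr
      _ = (β / δ) ^ β := by
          rw [mul_assoc, ← Real.exp_add]
          simp

/-- By genericity the k forms indexed by X are affine coordinates, and a linear isomorphism carries
Lebesgue measure to a multiple of Lebesgue measure. -/
theorem integrable_comp_affine {N k : ℕ} {g : Fin N → Space k →ᵃ[ℝ] ℝ} (hg : LinGeneric g)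
    {X : Finset (Fin N)} (hX : X.card = k) {F : (X → ℝ) → ℝ} (hF : Integrable F) :
    Integrable fun z => F fun j => g j z := by
  set T : Space k →ₗ[ℝ] (X → ℝ) := LinearMap.pi fun j => (g j).linear
  have hT : Function.Injective T := by
    rw [← LinearMap.ker_eq_bot, LinearMap.ker_eq_bot']
    intro v hv
    exact hg X hX v fun j hj => congrFun hv ⟨j, hj⟩
  set L : Space k ≃L[ℝ] (X → ℝ) :=
    (LinearEquiv.ofInjectiveOfFinrankEq T hT (by simp [hX])).toContinuousLinearEquiv
  have hL : ∀ z, L z = fun j : X => (g j).linear z := fun z => rfl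
  have h1 : Integrable (fun y => F (y + fun j : X => g j 0)) := hF.comp_add_right _
  have := L.isAddHaarMeasure_map (volume : Measure (Space k))
  have h2 : Integrable (fun y => F (y + fun j : X => g j 0))
      (Measure.map L (volume : Measure (Space k))) := by
    rw [Measure.isAddLeftInvariant_eq_smul (Measure.map L (volume : Measure (Space k))) volume]
    exact h1.smul_measure_nnreal
  have h3 := (integrable_map_equiv L.toHomeomorph.toMeasurableEquiv
    (fun y => F (y + fun j : X => g j 0))).1 h2
  refine h3.congr (Filter.Eventually.of_forall fun z => ?_)
  change F (L z + _) = _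
  rw [hL]
  congr 1
  funext j
  rw [affine_eq_linear_add (g j) z, add_comm]
  rfl

/-- The growth bound replaces e^{-ε f₀} by a constant times a product of factors e^{-δ g_j}. In the
coordinates from X the integrand becomes a product of Gamma integrands, while the factors outside X
are bounded. -/
theorem integrableOn_exp_mul_weight {N k : ℕ} {g : Fin N → Space k →ᵃ[ℝ] ℝ} (hg : LinGeneric g)
    {f₀ : Space k →ₗ[ℝ] ℝ} {c K : ℝ} (hc : 0 < c)
    (hgrow : ∀ z ∈ polyhedron g, c * ∑ j, g j z ≤ f₀ z + K)
    {X : Finset (Fin N)} (hX : X.card = k) {β : Fin N → ℝ} (hβX : ∀ j ∈ X, -1 < β j)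
    (hβ : ∀ j ∉ X, 0 ≤ β j) {ε : ℝ} (hε : 0 < ε) :
    IntegrableOn (fun z => Real.exp (-(ε * f₀ z)) * weight g β z) (polyhedron g) := by
  have hδ : 0 < ε * c := mul_pos hε hc
  set δ := ε * c with hδdef
  set h : Fin N → ℝ → ℝ := fun j =>
    (Set.Ioi (0 : ℝ)).indicator fun t => t ^ β j * Real.exp (-δ * t) with hh
  have hint : ∀ j : X, Integrable (h j) := by
    intro j
    rw [hh, integrable_indicator_iff measurableSet_Ioi]
    simpa using integrableOn_rpow_mul_exp_neg_mul_rpow (hβX j j.2) one_pos hδ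
  have hF : Integrable (fun y : X → ℝ => ∏ j : X, h j (y j)) := Integrable.fintype_prod hint
  have hFT := integrable_comp_affine hg hX hF
  have hex : ∀ j, ∃ C : ℝ, 0 ≤ C ∧ (j ∉ X → ∀ t : ℝ, 0 < t → t ^ β j * Real.exp (-δ * t) ≤ C) := by
    intro j
    by_cases hj : j ∈ X
    · exact ⟨0, le_rfl, fun h => absurd hj h⟩
    · obtain ⟨C, hC, hC'⟩ := exists_rpow_mul_exp_le (hβ j hj) hδ
      exact ⟨C, hC, fun _ => hC'⟩
  choose C hC hC' using hex
  refine ((hFT.const_mul (Real.exp (ε * K) * ∏ j ∈ Xᶜ, C j)).integrableOn).mono' ?_ ?_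
  · have : Continuous f₀ := LinearMap.continuous_of_finiteDimensional _
    exact ((by fun_prop : Continuous fun z => Real.exp (-(ε * f₀ z))).measurable.mul
      (measurable_weight g β)).aestronglyMeasurable
  · refine (ae_restrict_iff' (isOpen_polyhedron g).measurableSet).2
      (Filter.Eventually.of_forall fun z hz => ?_)
    rw [Real.norm_eq_abs, abs_of_pos (mul_pos (Real.exp_pos _) (weight_pos β hz))]
    have h1 : Real.exp (-(ε * f₀ z)) ≤ Real.exp (ε * K) * ∏ j, Real.exp (-δ * g j z) := by
      rw [← Real.exp_sum, ← Real.exp_add, Real.exp_le_exp, ← Finset.mul_sum]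
      have := mul_le_mul_of_nonneg_left (hgrow z hz) hε.le
      rw [hδdef]
      linarith
    calc Real.exp (-(ε * f₀ z)) * weight g β z
        ≤ (Real.exp (ε * K) * ∏ j, Real.exp (-δ * g j z)) * weight g β z :=
          mul_le_mul_of_nonneg_right h1 (weight_pos β hz).le
      _ = Real.exp (ε * K) * ∏ j, (g j z ^ β j * Real.exp (-δ * g j z)) := by
          rw [Finset.prod_mul_distrib, weight]; ring
      _ = Real.exp (ε * K) * ((∏ j ∈ Xᶜ, (g j z ^ β j * Real.exp (-δ * g j z))) *
            ∏ j : X, h j (g j z)) := by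
          rw [← Finset.prod_compl_mul_prod X]
          congr 2
          rw [← Finset.prod_coe_sort X]
          refine Finset.prod_congr rfl fun j _ => ?_
          rw [hh]
          exact (Set.indicator_of_mem (Set.mem_Ioi.2 (hz j))
            (fun t => t ^ β j * Real.exp (-δ * t))).symm
      _ ≤ Real.exp (ε * K) * ((∏ j ∈ Xᶜ, C j) * ∏ j : X, h j (g j z)) := by
          have hnn : ∀ j : X, 0 ≤ h j (g j z) := fun j =>
            Set.indicator_nonneg (fun t ht => mul_nonneg (Real.rpow_nonneg (le_of_lt ht) _)
              (Real.exp_pos _).le) _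
          refine mul_le_mul_of_nonneg_left (mul_le_mul_of_nonneg_right ?_
            (Finset.prod_nonneg fun j _ => hnn j)) (Real.exp_pos _).le
          refine Finset.prod_le_prod (fun j _ => mul_nonneg (Real.rpow_nonneg (hz j).le _)
            (Real.exp_pos _).le) fun j hj => hC' j (Finset.mem_compl.1 hj) _ (hz j)
      _ = _ := by ring

/-- The function `e ^ (-lam * f₀) * ∏ (g j) ^ (β j)`. -/
def expWeight {N k : ℕ} (g : Fin N → Space k →ᵃ[ℝ] ℝ) (f₀ : Space k →ₗ[ℝ] ℝ) (β : Fin N → ℝ)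
    (lam : ℂ) (z : Space k) : ℂ :=
  Complex.exp (-lam * (f₀ z : ℂ)) * (weight g β z : ℂ)

theorem measurable_expWeight {N k : ℕ} (g : Fin N → Space k →ᵃ[ℝ] ℝ) (f₀ : Space k →ₗ[ℝ] ℝ)
    (β : Fin N → ℝ) (lam : ℂ) : Measurable (expWeight g f₀ β lam) := by
  have : Continuous f₀ := LinearMap.continuous_of_finiteDimensional _
  exact (by fun_prop : Continuous fun z => Complex.exp (-lam * (f₀ z : ℂ))).measurable.mul
    (Complex.measurable_ofReal.comp (measurable_weight g β))

theorem norm_expWeight {N k : ℕ} {g : Fin N → Space k →ᵃ[ℝ] ℝ} (f₀ : Space k →ₗ[ℝ] ℝ)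
    (β : Fin N → ℝ) (lam : ℂ) {z : Space k} (hz : z ∈ polyhedron g) :
    ‖expWeight g f₀ β lam z‖ = Real.exp (-(lam.re * f₀ z)) * weight g β z := by
  rw [expWeight, norm_mul, Complex.norm_exp, Complex.norm_real, Real.norm_eq_abs,
    abs_of_pos (weight_pos β hz)]
  simp

theorem integrableOn_expWeight {N k : ℕ} {g : Fin N → Space k →ᵃ[ℝ] ℝ} (hg : LinGeneric g)
    {f₀ : Space k →ₗ[ℝ] ℝ} {c K : ℝ} (hc : 0 < c)
    (hgrow : ∀ z ∈ polyhedron g, c * ∑ j, g j z ≤ f₀ z + K)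
    {X : Finset (Fin N)} (hX : X.card = k) {β : Fin N → ℝ} (hβX : ∀ j ∈ X, -1 < β j)
    (hβ : ∀ j ∉ X, 0 ≤ β j) {lam : ℂ} (hlam : 0 < lam.re) :
    IntegrableOn (expWeight g f₀ β lam) (polyhedron g) := by
  refine (integrableOn_exp_mul_weight hg hc hgrow hX hβX hβ hlam).mono'
    (measurable_expWeight g f₀ β lam).aestronglyMeasurable ?_
  exact (ae_restrict_iff' (isOpen_polyhedron g).measurableSet).2
    (Filter.Eventually.of_forall fun z hz => (norm_expWeight f₀ β lam hz).le)

theorem hasDerivAt_integral_expWeight {N k : ℕ} {g : Fin N → Space k →ᵃ[ℝ] ℝ}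
    (hg : LinGeneric g) {f₀ : Space k →ₗ[ℝ] ℝ} {c K : ℝ} (hc : 0 < c)
    (hgrow : ∀ z ∈ polyhedron g, c * ∑ j, g j z ≤ f₀ z + K)
    {X : Finset (Fin N)} (hX : X.card = k) {β : Fin N → ℝ} (hβX : ∀ j ∈ X, -1 < β j)
    (hβ : ∀ j ∉ X, 0 ≤ β j) {lam : ℂ} (hlam : 0 < lam.re) :
    IntegrableOn (fun z => -(f₀ z : ℂ) * expWeight g f₀ β lam z) (polyhedron g) ∧
    HasDerivAt (fun l => ∫ z in polyhedron g, expWeight g f₀ β l z)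
      (∫ z in polyhedron g, -(f₀ z : ℂ) * expWeight g f₀ β lam z) lam := by
  have hP := (isOpen_polyhedron g).measurableSet
  have hf₀c : Continuous f₀ := LinearMap.continuous_of_finiteDimensional _
  set ρ := lam.re with hρ
  have hlow : ∀ z ∈ polyhedron g, 0 ≤ f₀ z + |K| := by
    intro z hz
    have h1 : 0 ≤ c * ∑ j, g j z := mul_nonneg hc.le (Finset.sum_nonneg fun j _ => (hz j).le)
    have := hgrow z hz
    have := le_abs_self K
    linarith
  -- On the ball of radius ρ/2 one has Re l ≥ ρ/2. Half of that decay absorbs the factor f₀, leaving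
  -- e^{-(ρ/4) f₀}; the shift by |K| makes f₀ nonnegative, and e^{2ρ|K|} pays for it.
  set bound : Space k → ℝ := fun z =>
    ((4 / ρ + |K|) * Real.exp (2 * ρ * |K|)) *
      (Real.exp (-(ρ / 4 * f₀ z)) * weight g β z)
  refine (hasDerivAt_integral_of_dominated_loc_of_deriv_le (𝕜 := ℂ)
    (F := fun l z => expWeight g f₀ β l z) (F' := fun l z => -(f₀ z : ℂ) * expWeight g f₀ β l z)
    (bound := bound) (Metric.ball_mem_nhds lam (half_pos hlam)) ?_ ?_ ?_ ?_ ?_ ?_)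
  · exact Filter.Eventually.of_forall fun l => (measurable_expWeight g f₀ β l).aestronglyMeasurable
  · exact integrableOn_expWeight hg hc hgrow hX hβX hβ hlam
  · exact ((by fun_prop : Continuous fun z => -(f₀ z : ℂ)).measurable.mul
      (measurable_expWeight g f₀ β lam)).aestronglyMeasurable
  · refine (ae_restrict_iff' hP).2 (Filter.Eventually.of_forall fun z hz l hl => ?_)
    have hre : ρ / 2 ≤ l.re := by
      have h1 : |(l - lam).re| ≤ ‖l - lam‖ := Complex.abs_re_le_norm _
      have h2 : ‖l - lam‖ < ρ / 2 := by simpa [dist_eq_norm] using hl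
      have h3 := neg_abs_le (l - lam).re
      rw [Complex.sub_re] at h1 h3
      linarith
    have hre' : l.re ≤ 2 * ρ := by
      have h1 : |(l - lam).re| ≤ ‖l - lam‖ := Complex.abs_re_le_norm _
      have h2 : ‖l - lam‖ < ρ / 2 := by simpa [dist_eq_norm] using hl
      have h3 := le_abs_self (l - lam).re
      rw [Complex.sub_re] at h1 h3
      linarith
    rw [norm_mul, norm_expWeight f₀ β l hz, norm_neg, Complex.norm_real, Real.norm_eq_abs]
    set y := f₀ z + |K| with hy
    have hy0 : 0 ≤ y := hlow z hz
    have hK := abs_nonneg K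
    have h1 : |f₀ z| ≤ (4 / ρ + |K|) * Real.exp (ρ / 4 * y) := by
      have e1 : ρ / 4 * y ≤ Real.exp (ρ / 4 * y) := by
        have := Real.add_one_le_exp (ρ / 4 * y)
        linarith
      have e2 : 1 ≤ Real.exp (ρ / 4 * y) := Real.one_le_exp (by positivity)
      have e4 : y ≤ 4 / ρ * Real.exp (ρ / 4 * y) := by
        calc y = 4 / ρ * (ρ / 4 * y) := by field_simp
          _ ≤ _ := by gcongr
      have e5 : |f₀ z| ≤ y + |K| := by
        rw [abs_le]; constructor <;> linarith
      nlinarith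
    have h2 : Real.exp (-(l.re * f₀ z)) ≤
        Real.exp (-(ρ / 2 * y)) * Real.exp (2 * ρ * |K|) := by
      rw [← Real.exp_add, Real.exp_le_exp]
      have e1 : f₀ z = y - |K| := by rw [hy]; ring
      rw [e1]
      nlinarith
    have hw := (weight_pos β hz).le
    calc |f₀ z| * (Real.exp (-(l.re * f₀ z)) * weight g β z)
        ≤ ((4 / ρ + |K|) * Real.exp (ρ / 4 * y)) *
          ((Real.exp (-(ρ / 2 * y)) * Real.exp (2 * ρ * |K|)) * weight g β z) := by
          gcongr
      _ = ((4 / ρ + |K|) * Real.exp (ρ / 4 * y + -(ρ / 2 * y) + 2 * ρ * |K|)) * weight g β z := by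
          rw [Real.exp_add, Real.exp_add]; ring
      _ ≤ bound z := by
          have : bound z = ((4 / ρ + |K|) *
              Real.exp (2 * ρ * |K| + -(ρ / 4 * f₀ z))) * weight g β z := by
            simp only [bound]
            rw [Real.exp_add]; ring
          rw [this]
          have e6 : ρ / 4 * y + -(ρ / 2 * y) + 2 * ρ * |K| ≤ 2 * ρ * |K| + -(ρ / 4 * f₀ z) := by
            have : 0 ≤ ρ * |K| := by positivity
            rw [hy]
            linarith
          gcongr
  · exact (integrableOn_exp_mul_weight hg hc hgrow hX hβX hβ (by positivity)).const_mul _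
  · refine Filter.Eventually.of_forall fun z l _ => ?_
    have h := ((hasDerivAt_id l).neg.mul_const (f₀ z : ℂ)).cexp.mul_const (weight g β z : ℂ)
    refine h.congr_deriv ?_
    simp only [expWeight, id, Pi.neg_apply]
    ring

/-! ### Integration by parts along an edge -/

/-- An integrable derivative along a direction, of an integrable function that is absolutely
continuous on lines, has zero integral. -/
theorem integral_eq_zero_of_hasDerivAt_line {k : ℕ} {G G' : Space k → ℂ} (hG : Integrable G)
    (hG' : Integrable G') (e : Space k)
    (hc : ∀ z, Continuous fun t : ℝ => G (z + t • e))
    (hd : ∀ z, ∃ s : Set ℝ, s.Countable ∧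
      ∀ t ∉ s, HasDerivAt (fun t : ℝ => G (z + t • e)) (G' (z + t • e)) t) :
    ∫ z, G' z = 0 := by
  -- Average over translations by t e with t ∈ (0, 1]: translation invariance leaves the integral of
  -- G' unchanged. For almost every z the inner integral is G (z + e) - G z, whose integral over z
  -- is zero.
  set ν : Measure ℝ := volume.restrict (Set.Ioc 0 1) with hν
  have hν1 : IsProbabilityMeasure ν := ⟨by simp [hν]⟩
  have hmp : MeasurePreserving (fun p : ℝ × Space k => (p.1, p.2 + p.1 • e))
      (ν.prod volume) (ν.prod volume) :=
    (MeasurePreserving.id ν).skew_product (g := fun t z => z + t • e)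
      (by fun_prop) (Filter.Eventually.of_forall fun t => map_add_right_eq_self volume (t • e))
  have hint : Integrable (fun p : ℝ × Space k => G' (p.2 + p.1 • e)) (ν.prod volume) :=
    hmp.integrable_comp_of_integrable (g := fun p : ℝ × Space k => G' p.2) (hG'.comp_snd ν)
  have h1 : ∀ᵐ z, ∫ t, G' (z + t • e) ∂ν = G (z + e) - G z := by
    filter_upwards [hint.prod_left_ae] with z hz
    obtain ⟨s, hs, hds⟩ := hd z
    have h := integral_eq_of_hasDerivAt_off_countable_of_le (fun t : ℝ => G (z + t • e))
      (fun t => G' (z + t • e)) zero_le_one hs (hc z).continuousOn (fun t ht => hds t ht.2)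
      ((intervalIntegrable_iff_integrableOn_Ioc_of_le zero_le_one).2 hz)
    rw [intervalIntegral.integral_of_le zero_le_one] at h
    simpa using h
  have h2 : ∫ z, ∫ t, G' (z + t • e) ∂ν = 0 := by
    rw [integral_congr_ae h1, integral_sub (hG.comp_add_right e) hG,
      integral_add_right_eq_self (μ := volume) G e, sub_self]
  have h3 := integral_integral_swap (f := fun t z => G' (z + t • e)) hint
  rw [h2] at h3
  simp_rw [integral_add_right_eq_self (μ := volume) G'] at h3
  simpa using h3

/-- The exponents `α`, lowered by one on `S`. -/
def lowered {N : ℕ} (α : Fin N → ℝ) (S : Finset (Fin N)) (j : Fin N) : ℝ :=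
  if j ∈ S then α j - 1 else α j

theorem hasDerivAt_weight_line {N k : ℕ} {g : Fin N → Space k →ᵃ[ℝ] ℝ} {α : Fin N → ℝ}
    {U : Finset (Fin N)} {e : Space k} (hU : ∀ j ∈ U, (g j).linear e = 0) {z : Space k} {t : ℝ}
    (hz : z + t • e ∈ polyhedron g) :
    HasDerivAt (fun t : ℝ => weight g (lowered α U) (z + t • e))
      (∑ r ∈ Uᶜ, α r * (g r).linear e * weight g (lowered α (insert r U)) (z + t • e)) t := by
  have hlin : ∀ j, HasDerivAt (fun t : ℝ => g j (z + t • e)) ((g j).linear e) t := by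
    intro j
    simp_rw [affine_add_smul]
    simpa using ((hasDerivAt_id t).mul_const ((g j).linear e)).const_add (g j z)
  have h := HasDerivAt.fun_finsetProd (u := Finset.univ) (x := t)
    fun j _ => (hlin j).rpow_const (p := lowered α U j) (Or.inl (hz j).ne')
  refine h.congr_deriv ?_
  rw [← Finset.sum_compl_add_sum U, add_eq_left.2]
  · refine Finset.sum_congr rfl fun r hr => ?_
    rw [Finset.mem_compl] at hr
    rw [weight, ← Finset.prod_erase_mul _ _ (Finset.mem_univ r)]
    have h1 : ∏ j ∈ Finset.univ.erase r, g j (z + t • e) ^ lowered α (insert r U) j =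
        ∏ j ∈ Finset.univ.erase r, g j (z + t • e) ^ lowered α U j := by
      refine Finset.prod_congr rfl fun j hj => ?_
      simp [lowered, Finset.ne_of_mem_erase hj]
    rw [h1]
    simp only [lowered, hr, Finset.mem_insert_self, if_true, if_false, smul_eq_mul]
    ring
  · refine Finset.sum_eq_zero fun j hj => ?_
    rw [hU j hj]
    simp

/-- The integral of the e-derivative of the integrand, extended by zero outside the polyhedron,
vanishes. Only the exponential and the forms outside U vary along e. -/
theorem integral_expWeight_lowered {N k : ℕ} {g : Fin N → Space k →ᵃ[ℝ] ℝ}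
    {f₀ : Space k →ₗ[ℝ] ℝ} {α : Fin N → ℝ} {U : Finset (Fin N)} {e : Space k} {lam : ℂ}
    (hU : ∀ j ∈ U, (g j).linear e = 0) (hUc : ∀ r ∉ U, (g r).linear e ≠ 0) (he : f₀ e = 1)
    (hα : ∀ r ∉ U, 0 < α r)
    (hint : IntegrableOn (expWeight g f₀ (lowered α U) lam) (polyhedron g))
    (hint' : ∀ r ∉ U, IntegrableOn (expWeight g f₀ (lowered α (insert r U)) lam) (polyhedron g)) :
    lam * ∫ z in polyhedron g, expWeight g f₀ (lowered α U) lam z =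
      ∑ r ∈ Uᶜ, ((α r * (g r).linear e : ℝ) : ℂ) *
        ∫ z in polyhedron g, expWeight g f₀ (lowered α (insert r U)) lam z := by
  have hP := (isOpen_polyhedron g).measurableSet
  set D : Space k → ℂ := fun z => -lam * expWeight g f₀ (lowered α U) lam z +
    ∑ r ∈ Uᶜ, ((α r * (g r).linear e : ℝ) : ℂ) *
      expWeight g f₀ (lowered α (insert r U)) lam z with hD
  have hi1 : IntegrableOn (fun z => -lam * expWeight g f₀ (lowered α U) lam z) (polyhedron g) :=
    hint.const_mul _
  have hi2 : ∀ r ∈ Uᶜ, IntegrableOn (fun z => ((α r * (g r).linear e : ℝ) : ℂ) *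
      expWeight g f₀ (lowered α (insert r U)) lam z) (polyhedron g) := fun r hr =>
    (hint' r (Finset.mem_compl.1 hr)).const_mul _
  have hDint : IntegrableOn D (polyhedron g) := hi1.add (integrable_finsetSum _ hi2)
  have hzero := integral_eq_zero_of_hasDerivAt_line
    (G := (polyhedron g).indicator (expWeight g f₀ (lowered α U) lam))
    (G' := (polyhedron g).indicator D) ((integrable_indicator_iff hP).2 hint)
    ((integrable_indicator_iff hP).2 hDint) e ?_ ?_
  · rw [integral_indicator hP] at hzero
    simp only [hD] at hzero
    rw [integral_add hi1 (integrable_finsetSum _ hi2), integral_finsetSum _ hi2] at hzero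
    simp_rw [integral_const_mul] at hzero
    linear_combination -hzero
  · intro z
    -- The forms in U are constant along the line. If all are positive, the extension by zero is
    -- obtained by replacing each other form by its positive part, which is continuous because its
    -- exponent is positive. Otherwise the line misses the polyhedron.
    by_cases hz : ∀ j ∈ U, 0 < g j z
    · have heq : (fun t : ℝ => (polyhedron g).indicator (expWeight g f₀ (lowered α U) lam)
          (z + t • e)) = fun t : ℝ => Complex.exp (-lam * ((f₀ z + t * f₀ e : ℝ) : ℂ)) *
          (((∏ r ∈ Uᶜ, (max (g r z + t * (g r).linear e) 0) ^ α r) *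
            ∏ j ∈ U, g j z ^ (α j - 1) : ℝ) : ℂ) := by
        funext t
        by_cases ht : z + t • e ∈ polyhedron g
        · rw [Set.indicator_of_mem ht, expWeight, weight, map_add, map_smul, smul_eq_mul,
            ← Finset.prod_compl_mul_prod U]
          congr 3
          · refine Finset.prod_congr rfl fun r hr => ?_
            have := ht r
            rw [affine_add_smul] at this
            rw [affine_add_smul, max_eq_left this.le, lowered, if_neg (Finset.mem_compl.1 hr)]
          · refine Finset.prod_congr rfl fun j hj => ?_
            rw [affine_add_smul, hU j hj, mul_zero, add_zero, lowered, if_pos hj]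
        · rw [Set.indicator_of_notMem ht]
          have : ∃ r, g r (z + t • e) ≤ 0 := by
            by_contra! hcon
            exact ht hcon
          obtain ⟨r, hr⟩ := this
          rw [affine_add_smul] at hr
          have hrU : r ∉ U := fun h => by
            rw [hU r h, mul_zero, add_zero] at hr
            exact absurd hr (not_le.2 (hz r h))
          rw [Finset.prod_eq_zero (Finset.mem_compl.2 hrU)
            (by rw [max_eq_right hr, Real.zero_rpow (hα r hrU).ne'])]
          simp
      rw [heq]
      have hpc : Continuous fun t : ℝ =>
          (∏ r ∈ Uᶜ, (max (g r z + t * (g r).linear e) 0) ^ α r) *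
            ∏ j ∈ U, g j z ^ (α j - 1) :=
        (continuous_finsetProd _ fun r hr => Continuous.rpow_const (by fun_prop)
          fun t => Or.inr (hα r (Finset.mem_compl.1 hr)).le).mul continuous_const
      exact (by fun_prop : Continuous fun t : ℝ =>
        Complex.exp (-lam * ((f₀ z + t * f₀ e : ℝ) : ℂ))).mul (Complex.continuous_ofReal.comp hpc)
    · have heq : (fun t : ℝ => (polyhedron g).indicator (expWeight g f₀ (lowered α U) lam)
          (z + t • e)) = fun _ => 0 := by
        push Not at hz
        obtain ⟨j, hj, hjz⟩ := hz
        funext t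
        refine Set.indicator_of_notMem (fun ht => ?_) _
        have := ht j
        rw [affine_add_smul, hU j hj, mul_zero, add_zero] at this
        exact absurd this (not_lt.2 hjz)
      rw [heq]
      exact continuous_const
  · intro z
    -- The parameters at which the line crosses some H_r, r ∉ U. Indices in U only add the harmless
    -- value 0 through division by zero.
    refine ⟨Set.range fun r => -g r z / (g r).linear e, Set.countable_range _, fun t ht => ?_⟩
    have htne : ∀ r ∉ U, g r (z + t • e) ≠ 0 := fun r hr h => by
      refine ht ⟨r, ?_⟩
      rw [affine_add_smul] at h
      have := hUc r hr
      field_simp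
      linarith
    have hline : Continuous fun t : ℝ => z + t • e := by fun_prop
    by_cases hz : z + t • e ∈ polyhedron g
    · rw [Set.indicator_of_mem hz]
      have hev : (fun t : ℝ => (polyhedron g).indicator (expWeight g f₀ (lowered α U) lam)
          (z + t • e)) =ᶠ[nhds t] fun t : ℝ => expWeight g f₀ (lowered α U) lam (z + t • e) := by
        filter_upwards [hline.continuousAt.preimage_mem_nhds ((isOpen_polyhedron g).mem_nhds hz)]
          with u hu
        exact Set.indicator_of_mem (s := polyhedron g) hu (expWeight g f₀ (lowered α U) lam)
      refine HasDerivAt.congr_of_eventuallyEq ?_ hev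
      have h1 : HasDerivAt (fun t : ℝ => ((f₀ (z + t • e) : ℝ) : ℂ)) 1 t := by
        have : HasDerivAt (fun t : ℝ => f₀ (z + t • e)) 1 t := by
          simp only [map_add, map_smul, he, smul_eq_mul, mul_one]
          exact (hasDerivAt_id t).const_add _
        simpa using this.ofReal_comp
      have h2 := (hasDerivAt_weight_line (α := α) hU hz).ofReal_comp
      refine ((h1.const_mul (-lam)).cexp.mul h2).congr_deriv ?_
      simp only [hD, expWeight]
      push_cast
      rw [Finset.mul_sum]
      congr 1
      · ring
      · exact Finset.sum_congr rfl fun r _ => by ring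
    · rw [Set.indicator_of_notMem hz]
      have : ∃ r, g r (z + t • e) ≤ 0 := by
        by_contra! hcon
        exact hz hcon
      obtain ⟨r, hr⟩ := this
      have hev : (fun t : ℝ => (polyhedron g).indicator (expWeight g f₀ (lowered α U) lam)
          (z + t • e)) =ᶠ[nhds t] fun _ => (0 : ℂ) := by
        by_cases hrU : r ∈ U
        · refine Filter.Eventually.of_forall fun u => Set.indicator_of_notMem (fun hu => ?_) _
          have := hu r
          rw [affine_add_smul, hU r hrU, mul_zero] at this hr
          linarith
        · have hlt : g r (z + t • e) < 0 := lt_of_le_of_ne hr (htne r hrU)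
          filter_upwards [((affine_continuous (g r)).comp hline).continuousAt.eventually_lt
            continuousAt_const hlt] with u hu
          refine Set.indicator_of_notMem (fun h => ?_) _
          exact absurd (h r) (not_lt.2 (le_of_lt hu))
      exact (hasDerivAt_const t (0 : ℂ)).congr_of_eventuallyEq hev

/-! ### Determinants and the coefficient of the vertex form -/

/-- The absolute value of the determinant of the linear parts of the `f j`, `j ∈ X`. -/
def volCoeff {N k : ℕ} (f : Fin N → Space k →ᵃ[ℝ] ℝ) (X : Vertex N k) : ℝ :=
  |wedge (fun i => (f (X.1.orderEmbOfFin X.2 i)).linear) (EuclideanSpace.basisFun (Fin k) ℝ)|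

theorem orientedCoeff_posOriented {k : ℕ} (o : Orientation ℝ (Space k) (Fin k))
    (η : Space k [⋀^Fin k]→ₗ[ℝ] ℝ) :
    orientedCoeff o (posOriented o η) = |η (EuclideanSpace.basisFun (Fin k) ℝ)| := by
  have h : |orientedCoeff o η| = |η (EuclideanSpace.basisFun (Fin k) ℝ)| := by
    rw [orientedCoeff, abs_mul]
    split_ifs <;> simp
  rw [← h, posOriented]
  split_ifs with h0
  · exact (abs_of_pos h0).symm
  · rw [orientedCoeff_neg, abs_of_nonpos (not_lt.1 h0)]

theorem volCoeff_eq {N k : ℕ} (f : Fin N → Space k →ᵃ[ℝ] ℝ) (X : Vertex N k) (ψ : Fin k → Fin N)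
    (hψ : Function.Injective ψ) (hX : ∀ i, ψ i ∈ X.1) :
    volCoeff f X =
      |wedge (fun i => (f (ψ i)).linear) (EuclideanSpace.basisFun (Fin k) ℝ)| := by
  have hb : Function.Bijective fun i => (⟨ψ i, hX i⟩ : X.1) :=
    (Fintype.bijective_iff_injective_and_card _).2
      ⟨fun a b h => hψ (congrArg Subtype.val h), by simp [X.2]⟩
  set e := Equiv.ofBijective _ hb
  set e₀ : Fin k ≃ X.1 := (X.1.orderIsoOfFin X.2).toEquiv
  have h := wedge_perm (fun i => (f (e₀ i)).linear) (e.trans e₀.symm)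
  simp only [Equiv.trans_apply, Equiv.apply_symm_apply] at h
  have h1 : (fun i => (f (ψ i)).linear) = fun i => (f (e i)).linear := rfl
  have h2 : (fun i => (f (X.1.orderEmbOfFin X.2 i)).linear) = fun i => (f (e₀ i)).linear := rfl
  rw [volCoeff, h1, h2, h, AlternatingMap.smul_apply, smul_eq_mul, abs_mul]
  rcases Int.units_eq_one_or (Equiv.Perm.sign (e.trans e₀.symm)) with hs | hs <;> simp [hs]

theorem linear_eq_sum_basis {k : ℕ} (l : Space k →ₗ[ℝ] ℝ) (e : Space k) :
    ∑ m, l (EuclideanSpace.basisFun (Fin k) ℝ m) * e m = l e := by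
  conv_rhs => rw [← (EuclideanSpace.basisFun (Fin k) ℝ).sum_repr e]
  rw [map_sum]
  refine Finset.sum_congr rfl fun m _ => ?_
  rw [map_smul, smul_eq_mul, mul_comm]
  simp

/-- The two determinants differ in one row. Subtracting the multiple of l_j that makes the new row
vanish on e leaves a matrix with e in its kernel, so the determinants are in the ratio of l_r(e) to
l_j(e). -/
theorem volCoeff_insert {N k : ℕ} (f : Fin N → Space k →ᵃ[ℝ] ℝ) {U : Finset (Fin N)}
    {X Y : Vertex N k} {j r : Fin N} (hr : r ∉ U) (hX : X.1 = insert j U)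
    (hY : Y.1 = insert r U) {e : Space k} (he : ∀ i ∈ U, (f i).linear e = 0)
    (hje : (f j).linear e ≠ 0) :
    volCoeff f X * |(f r).linear e| = volCoeff f Y * |(f j).linear e| := by
  set b := EuclideanSpace.basisFun (Fin k) ℝ
  set φ : Fin k → Fin N := ⇑(X.1.orderEmbOfFin X.2)
  have hφ : Function.Injective φ := (X.1.orderEmbOfFin X.2).injective
  obtain ⟨i₀, hi₀⟩ : ∃ i, φ i = j := by
    have h : j ∈ Set.range φ := by
      rw [Finset.range_orderEmbOfFin, hX]
      simp
    exact h
  have hφU : ∀ i, i ≠ i₀ → φ i ∈ U := by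
    intro i hi
    have h : φ i ∈ X.1 := Finset.orderEmbOfFin_mem _ _ _
    rw [hX, Finset.mem_insert] at h
    exact h.resolve_left fun h => hi (hφ (h.trans hi₀.symm))
  set ψ : Fin k → Fin N := Function.update φ i₀ r
  have hψ₀ : ψ i₀ = r := Function.update_self ..
  have hψne : ∀ i, i ≠ i₀ → ψ i = φ i := fun i hi => Function.update_of_ne hi ..
  have hψ : Function.Injective ψ := by
    intro a c hac
    by_cases ha : a = i₀ <;> by_cases hc : c = i₀
    · rw [ha, hc]
    · rw [ha, hψ₀, hψne c hc] at hac
      exact absurd (hac ▸ hφU c hc) hr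
    · rw [hc, hψ₀, hψne a ha] at hac
      exact absurd (hac ▸ hφU a ha) hr
    · rw [hψne a ha, hψne c hc] at hac
      exact hφ hac
  have hψY : ∀ i, ψ i ∈ Y.1 := by
    intro i
    rw [hY, Finset.mem_insert]
    by_cases hi : i = i₀
    · exact Or.inl (by rw [hi, hψ₀])
    · exact Or.inr (by rw [hψne i hi]; exact hφU i hi)
  set row : Fin N → Fin k → ℝ := fun i m => (f i).linear (b m)
  have hw : ∀ χ : Fin k → Fin N, wedge (fun i => (f (χ i)).linear) b =
      (Matrix.of fun i => row (χ i)).det := fun χ => by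
    rw [← Matrix.det_transpose]
    rfl
  rw [volCoeff_eq f X φ hφ fun i => Finset.orderEmbOfFin_mem _ _ _,
    volCoeff_eq f Y ψ hψ hψY, hw, hw, ← abs_mul, ← abs_mul]
  set A : Matrix (Fin k) (Fin k) ℝ := Matrix.of fun i => row (φ i)
  have hAψ : (Matrix.of fun i => row (ψ i)) = A.updateRow i₀ (row r) := by
    ext i m
    by_cases hi : i = i₀
    · subst hi
      simp [hψ₀]
    · simp [Matrix.updateRow_ne hi, hψne i hi, A]
  have hAφ : A.updateRow i₀ (row j) = A := by
    ext i m
    by_cases hi : i = i₀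
    · subst hi
      simp [A, hi₀]
    · simp [Matrix.updateRow_ne hi]
  set c := (f r).linear e / (f j).linear e
  have hdot : ∀ i, ∑ m, row i m * e m = (f i).linear e := fun i => linear_eq_sum_basis _ e
  have hzero : (A.updateRow i₀ (row r - c • row j)).det = 0 := by
    rw [← Matrix.exists_mulVec_eq_zero_iff]
    refine ⟨fun m => e m, fun h => hje ?_, ?_⟩
    · have : e = 0 := by
        ext m
        exact congrFun h m
      rw [this, map_zero]
    · funext i
      simp only [Matrix.mulVec, dotProduct, Pi.zero_apply]
      by_cases hi : i = i₀
      · subst hi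
        simp only [Matrix.updateRow_self, Pi.sub_apply, Pi.smul_apply, smul_eq_mul, sub_mul,
          mul_assoc, Finset.sum_sub_distrib, ← Finset.mul_sum, hdot]
        rw [div_mul_cancel₀ _ hje, sub_self]
      · simp only [Matrix.updateRow_ne hi]
        exact (hdot (φ i)).trans (he _ (hφU i hi))
  have hsplit : row r = c • row j + (row r - c • row j) := by abel
  rw [hAψ, hsplit, Matrix.det_updateRow_add, Matrix.det_updateRow_smul, hzero, hAφ, add_zero]
  congr 1
  rw [mul_right_comm, div_mul_cancel₀ _ hje, mul_comm]

/-- On the polyhedron |f_j| = g_j and 1/f_j = s_j/g_j, so the poles lower the exponents on X and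
contribute the signs. The choice of orientation makes the determinant enter by its absolute value.
-/
theorem integrand_eq {N k : ℕ} (o : Orientation ℝ (Space k) (Fin k))
    (f : Fin N → Space k →ᵃ[ℝ] ℝ) (f₀ : Space k →ₗ[ℝ] ℝ) (α : Fin N → ℝ) (X : Vertex N k)
    (lam : ℂ) {s : Fin N → ℝ} (hs : ∀ j, s j * s j = 1) {z : Space k}
    (hz : z ∈ polyhedron fun j => s j • f j) :
    integrand o f f₀ α X lam z = ((volCoeff f X * ∏ j ∈ X.1, s j : ℝ) : ℂ) *
      expWeight (fun j => s j • f j) f₀ (lowered α X.1) lam z := by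
  have hpos : ∀ j, 0 < s j * f j z := hz
  have habs : ∀ j, |f j z| = s j * f j z := fun j => by
    have h1 : |s j| = 1 := by
      rw [← sq_eq_sq₀ (abs_nonneg _) zero_le_one, sq_abs, sq, hs, one_pow]
    rw [← abs_of_pos (hpos j), abs_mul, h1, one_mul]
  have hoc : orientedCoeff o (vertexForm o f X z) = (∏ j ∈ X.1, f j z)⁻¹ * volCoeff f X := by
    rw [volCoeff, ← orientedCoeff_posOriented o, vertexForm]
    simp only [orientedCoeff, AlternatingMap.smul_apply, smul_eq_mul]
    ring
  have hw : (∏ j, |f j z| ^ α j) * (∏ j ∈ X.1, f j z)⁻¹ =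
      (∏ j ∈ X.1, s j) * weight (fun j => s j • f j) (lowered α X.1) z := by
    rw [weight, ← Finset.prod_mul_prod_compl X.1, ← Finset.prod_mul_prod_compl X.1,
      mul_right_comm, ← mul_assoc]
    congr 1
    · rw [← Finset.prod_inv_distrib, ← Finset.prod_mul_distrib, ← Finset.prod_mul_distrib]
      refine Finset.prod_congr rfl fun j hj => ?_
      change _ = s j * (s j * f j z) ^ _
      have hfz : f j z ≠ 0 := fun h => by
        have := hpos j
        rw [h, mul_zero] at this
        exact lt_irrefl _ this
      have hsz : s j ≠ 0 := fun h => by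
        have := hs j
        rw [h, mul_zero] at this
        exact zero_ne_one this
      rw [habs, lowered, if_pos hj, Real.rpow_sub_one (hpos j).ne']
      field_simp
    · refine Finset.prod_congr rfl fun j hj => ?_
      change _ = (s j * f j z) ^ _
      rw [habs, lowered, if_neg (Finset.mem_compl.1 hj)]
  rw [integrand, hoc, expWeight, ← mul_assoc, hw]
  push_cast
  ring

/-! ### The matrix B as a sum over exchanges of one index -/

/-- The vertex obtained from `X` by replacing `j` with `r`. -/
def swapVertex {N k : ℕ} (X : Vertex N k) (j r : Fin N) : Vertex N k :=
  if h : (insert r (X.1.erase j)).card = k then ⟨_, h⟩ else X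

theorem swapVertex_val {N k : ℕ} (X : Vertex N k) {j r : Fin N} (hj : j ∈ X.1)
    (hr : r ∉ X.1.erase j) : (swapVertex X j r).1 = insert r (X.1.erase j) := by
  have h : (insert r (X.1.erase j)).card = k := by
    rw [Finset.card_insert_of_notMem hr, Finset.card_erase_add_one hj, X.2]
  rw [swapVertex, dif_pos h]

theorem swapVertex_self {N k : ℕ} (X : Vertex N k) {j : Fin N} (hj : j ∈ X.1) :
    swapVertex X j j = X :=
  Subtype.ext (by rw [swapVertex_val X hj (by simp), Finset.insert_erase hj])

theorem card_erase_add_one {N k : ℕ} (X : Vertex N k) {j : Fin N} (hj : j ∈ X.1) :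
    (X.1.erase j).card + 1 = k := by
  rw [Finset.card_erase_add_one hj, X.2]

theorem matB_swapVertex {N k : ℕ} (f : Fin N → Space k →ᵃ[ℝ] ℝ) (f₀ : Space k →ₗ[ℝ] ℝ)
    (α : Fin N → ℝ) (X : Vertex N k) {j r : Fin N} (hj : j ∈ X.1) (hr : r ∉ X.1) :
    matB f f₀ α X (swapVertex X j r) = relSign f f₀ j r (X.1.erase j) * α r := by
  have hv := swapVertex_val X hj (fun h => hr (Finset.mem_of_mem_erase h))
  have hjr : j ≠ r := fun h => hr (h ▸ hj)
  have hne : X ≠ swapVertex X j r := fun h => by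
    have : r ∈ X.1 := by rw [h, hv]; exact Finset.mem_insert_self _ _
    exact hr this
  have h1 : X.1 ∩ (swapVertex X j r).1 = X.1.erase j := by
    rw [hv]; ext i; simp only [Finset.mem_inter, Finset.mem_insert, Finset.mem_erase]; grind
  have h2 : X.1 \ (swapVertex X j r).1 = {j} := by
    rw [hv]; ext i
    simp only [Finset.mem_sdiff, Finset.mem_insert, Finset.mem_erase, Finset.mem_singleton]; grind
  have h3 : (swapVertex X j r).1 \ X.1 = {r} := by
    rw [hv]; ext i
    simp only [Finset.mem_sdiff, Finset.mem_insert, Finset.mem_erase, Finset.mem_singleton]; grind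
  rw [matB, Matrix.of_apply, if_neg hne, h1, if_pos (card_erase_add_one X hj), h2, h3,
    Finset.sum_singleton, Finset.sum_singleton]

theorem exists_swapVertex_of_matB_ne_zero {N k : ℕ} {f : Fin N → Space k →ᵃ[ℝ] ℝ}
    {f₀ : Space k →ₗ[ℝ] ℝ} {α : Fin N → ℝ} {X Y : Vertex N k} (hXY : Y ≠ X)
    (h : matB f f₀ α X Y ≠ 0) : ∃ j ∈ X.1, ∃ r ∉ X.1, swapVertex X j r = Y := by
  rw [matB, Matrix.of_apply, if_neg hXY.symm] at h
  have hc : (X.1 ∩ Y.1).card + 1 = k := by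
    by_contra hcon
    exact h (if_neg hcon)
  have h1 := Finset.card_sdiff_add_card_inter X.1 Y.1
  have h2 := Finset.card_sdiff_add_card_inter Y.1 X.1
  rw [Finset.inter_comm Y.1] at h2
  rw [X.2] at h1
  rw [Y.2] at h2
  obtain ⟨j, hj⟩ := Finset.card_eq_one.1 (by omega : (X.1 \ Y.1).card = 1)
  obtain ⟨r, hr⟩ := Finset.card_eq_one.1 (by omega : (Y.1 \ X.1).card = 1)
  have hj' : ∀ i, (i ∈ X.1 ∧ i ∉ Y.1) ↔ i = j := fun i => by
    rw [← Finset.mem_sdiff, hj, Finset.mem_singleton]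
  have hr' : ∀ i, (i ∈ Y.1 ∧ i ∉ X.1) ↔ i = r := fun i => by
    rw [← Finset.mem_sdiff, hr, Finset.mem_singleton]
  have hjX := (hj' j).2 rfl
  have hrY := (hr' r).2 rfl
  refine ⟨j, hjX.1, r, hrY.2, Subtype.ext ?_⟩
  rw [swapVertex_val X hjX.1 (fun h => hrY.2 (Finset.mem_of_mem_erase h))]
  ext i
  have := hj' i
  have := hr' i
  simp only [Finset.mem_insert, Finset.mem_erase]
  grind

/-- Integration by parts naturally produces a sum over pairs (j, r). The pairs with r = j return X
with sign +1 and make up the diagonal entry; the others reach each neighbour of X exactly once. -/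
theorem sum_swapVertex {N k : ℕ} {f : Fin N → Space k →ᵃ[ℝ] ℝ} (hf : IsGeneric f) (hN : k ≤ N)
    {f₀ : Space k →ₗ[ℝ] ℝ} (hf₀ : IsGenericForm f f₀) (α : Fin N → ℝ) (X : Vertex N k)
    (F : Vertex N k → ℂ) :
    ∑ j ∈ X.1, ∑ r ∈ (X.1.erase j)ᶜ,
        ((relSign f f₀ j r (X.1.erase j) * α r : ℝ) : ℂ) * F (swapVertex X j r) =
      ∑ Y, (matB f f₀ α X Y : ℂ) * F Y := by
  have hsplit : ∀ j ∈ X.1, ∑ r ∈ (X.1.erase j)ᶜ,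
      ((relSign f f₀ j r (X.1.erase j) * α r : ℝ) : ℂ) * F (swapVertex X j r) =
      (α j : ℂ) * F X + ∑ r ∈ X.1ᶜ, (matB f f₀ α X (swapVertex X j r) : ℂ) *
        F (swapVertex X j r) := by
    intro j hj
    rw [Finset.compl_erase, Finset.sum_insert (by simpa using hj), swapVertex_self X hj]
    congr 1
    · have hne := linear_edgeVector_ne_zero hf hN hf₀ (card_erase_add_one X hj)
        (Finset.notMem_erase j X.1)
      rw [relSign, Real.sign_of_pos (mul_self_pos.2 hne), one_mul]
    · exact Finset.sum_congr rfl fun r hr => by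
        rw [matB_swapVertex f f₀ α X hj (Finset.mem_compl.1 hr)]
  rw [Finset.sum_congr rfl hsplit, Finset.sum_add_distrib, ← Finset.sum_mul,
    ← Finset.add_sum_erase _ _ (Finset.mem_univ X)]
  congr 1
  · simp [matB]
  · rw [← Finset.sum_product']
    refine Finset.sum_of_injOn (fun p => swapVertex X p.1 p.2) ?_ ?_ ?_ fun _ _ => rfl
    · rintro ⟨j, r⟩ hp ⟨i, t⟩ hq h
      simp only [Finset.coe_product, Set.mem_prod, Finset.mem_coe, Finset.mem_compl] at hp hq
      have h' := congrArg Subtype.val h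
      simp only at h'
      rw [swapVertex_val X hp.1 (fun h => hp.2 (Finset.mem_of_mem_erase h)),
        swapVertex_val X hq.1 (fun h => hq.2 (Finset.mem_of_mem_erase h))] at h'
      have hj := Finset.ext_iff.1 h' j
      have hr := Finset.ext_iff.1 h' r
      simp only [Finset.mem_insert, Finset.mem_erase] at hj hr
      grind
    · rintro ⟨j, r⟩ hp
      simp only [Finset.coe_product, Set.mem_prod, Finset.mem_coe, Finset.mem_compl] at hp
      simp only [Finset.coe_erase, Finset.coe_univ, Set.mem_sdiff, Set.mem_univ, true_and,
        Set.mem_singleton_iff]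
      intro h
      have h' := congrArg Subtype.val h
      rw [swapVertex_val X hp.1 (fun h => hp.2 (Finset.mem_of_mem_erase h))] at h'
      exact hp.2 (h' ▸ Finset.mem_insert_self _ _)
    · intro Y hY hnot
      by_contra hne
      obtain ⟨j, hj, r, hr, h⟩ := exists_swapVertex_of_matB_ne_zero (Finset.ne_of_mem_erase hY)
        (fun h0 => hne (by rw [h0, Complex.ofReal_zero, zero_mul]))
      exact hnot ⟨(j, r), by simpa using ⟨hj, hr⟩, h⟩

/-! ### Expansion of f₀ at a vertex and the resulting identity -/

/-- The edge vector of X \ {j} is killed by every l_i, i ∈ X, other than l_j. Hence z minus the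
vertex is the combination of edge vectors with coefficients f_j(z)/l_j(e), and f₀ is 1 on each. -/
theorem form_eq_sum {N k : ℕ} {f : Fin N → Space k →ᵃ[ℝ] ℝ} (hf : IsGeneric f) (hN : k ≤ N)
    {f₀ : Space k →ₗ[ℝ] ℝ} (hf₀ : IsGenericForm f f₀) (X : Vertex N k) (z : Space k) :
    f₀ z = f₀ (vertexPoint f X) +
      ∑ j ∈ X.1, f j z / (f j).linear (edgeVector f f₀ (X.1.erase j)) := by
  have hzero := hf.linGeneric X.1 X.2 (z - vertexPoint f X -
    ∑ j ∈ X.1, (f j z / (f j).linear (edgeVector f f₀ (X.1.erase j))) •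
      edgeVector f f₀ (X.1.erase j)) (by
    intro i hi
    rw [map_sub, affine_sub, flat_vertexPoint hf X hi, map_sum, Finset.sum_eq_single_of_mem i hi]
    · have := linear_edgeVector_ne_zero hf hN hf₀ (card_erase_add_one X hi)
        (Finset.notMem_erase i X.1)
      rw [map_smul, smul_eq_mul, div_mul_cancel₀ _ this]
      ring
    · intro j hj hji
      rw [map_smul, (edgeVector_spec hf hN hf₀ (card_erase_add_one X hj)).1 i
        (Finset.mem_erase.2 ⟨hji.symm, hi⟩), smul_zero])
  have h := congrArg f₀ hzero
  rw [map_sub, map_sub, map_sum, map_zero] at h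
  have h2 : ∑ j ∈ X.1, f₀ ((f j z / (f j).linear (edgeVector f f₀ (X.1.erase j))) •
      edgeVector f f₀ (X.1.erase j)) =
      ∑ j ∈ X.1, f j z / (f j).linear (edgeVector f f₀ (X.1.erase j)) :=
    Finset.sum_congr rfl fun j hj => by
      rw [map_smul, (edgeVector_spec hf hN hf₀ (card_erase_add_one X hj)).2, smul_eq_mul, mul_one]
  rw [h2] at h
  linarith

theorem mul_expWeight_lowered {N k : ℕ} {g : Fin N → Space k →ᵃ[ℝ] ℝ} (f₀ : Space k →ₗ[ℝ] ℝ)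
    (α : Fin N → ℝ) {X : Finset (Fin N)} {j : Fin N} (hj : j ∈ X) (lam : ℂ) {z : Space k}
    (hz : z ∈ polyhedron g) :
    (g j z : ℂ) * expWeight g f₀ (lowered α X) lam z =
      expWeight g f₀ (lowered α (X.erase j)) lam z := by
  have hw : g j z * weight g (lowered α X) z = weight g (lowered α (X.erase j)) z := by
    rw [weight, weight, ← Finset.mul_prod_erase _ _ (Finset.mem_univ j),
      ← Finset.mul_prod_erase _ _ (Finset.mem_univ j), ← mul_assoc]
    congr 1
    · simp only [lowered, hj, if_true, Finset.notMem_erase, if_false]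
      rw [Real.rpow_sub_one (hz j).ne', mul_div_cancel₀ _ (hz j).ne']
    · refine Finset.prod_congr rfl fun i hi => ?_
      simp [lowered, Finset.ne_of_mem_erase hi]
  rw [expWeight, expWeight, ← hw]
  push_cast
  ring

theorem sign_mul_eq {a b p q : ℝ} (ha : a ≠ 0) (h : p * |b| = q * |a|) :
    Real.sign (a * b) * q = p * (b / a) := by
  rw [mul_div_assoc', eq_div_iff ha]
  rcases lt_or_gt_of_ne ha with ha | ha <;> rcases lt_trichotomy b 0 with hb | rfl | hb
  · rw [Real.sign_of_pos (mul_pos_of_neg_of_neg ha hb)]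
    rw [abs_of_neg ha, abs_of_neg hb] at h
    linarith
  · simp
  · rw [Real.sign_of_neg (mul_neg_of_neg_of_pos ha hb)]
    rw [abs_of_neg ha, abs_of_pos hb] at h
    linarith
  · rw [Real.sign_of_neg (mul_neg_of_pos_of_neg ha hb)]
    rw [abs_of_pos ha, abs_of_neg hb] at h
    linarith
  · simp
  · rw [Real.sign_of_pos (mul_pos ha hb)]
    rw [abs_of_pos ha, abs_of_pos hb] at h
    linarith

/-- The whole differential equation in integrated form: the left side encodes (f₀ - f₀(X)) acting on
the integral, the right side is row X of B. -/
theorem mul_integral_expWeight {N k : ℕ} {f : Fin N → Space k →ᵃ[ℝ] ℝ} (hf : IsGeneric f)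
    (hN : k ≤ N) {f₀ : Space k →ₗ[ℝ] ℝ} (hf₀ : IsGenericForm f f₀) {α : Fin N → ℝ}
    {s : Fin N → ℝ} (hs : ∀ j, s j * s j = 1) {lam : ℂ}
    (hint : ∀ S X : Finset (Fin N), X.card = k → S ⊆ X →
      IntegrableOn (expWeight (fun j => s j • f j) f₀ (lowered α S) lam)
        (polyhedron fun j => s j • f j))
    (hα : ∀ j, 0 < α j) (X : Vertex N k) :
    lam * ((volCoeff f X * ∏ j ∈ X.1, s j : ℝ) : ℂ) *
        ∫ z in polyhedron fun j => s j • f j,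
          ((f₀ z - f₀ (vertexPoint f X) : ℝ) : ℂ) *
            expWeight (fun j => s j • f j) f₀ (lowered α X.1) lam z =
      ∑ Y, (matB f f₀ α X Y : ℂ) * (((volCoeff f Y * ∏ j ∈ Y.1, s j : ℝ) : ℂ) *
        ∫ z in polyhedron fun j => s j • f j,
          expWeight (fun j => s j • f j) f₀ (lowered α Y.1) lam z) := by
  set g : Fin N → Space k →ᵃ[ℝ] ℝ := fun j => s j • f j with hg
  have hP := (isOpen_polyhedron g).measurableSet
  have hs0 : ∀ j, s j ≠ 0 := fun j h => by
    have := hs j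
    rw [h, mul_zero] at this
    exact zero_ne_one this
  have hglin : ∀ j v, (g j).linear v = s j * (f j).linear v := fun j v => rfl
  have hgf : ∀ j z, f j z = s j * g j z := fun j z => by
    change f j z = s j * (s j * f j z)
    rw [← mul_assoc, hs, one_mul]
  have hi : ∀ j ∈ X.1, IntegrableOn (fun z =>
      ((s j / (f j).linear (edgeVector f f₀ (X.1.erase j)) : ℝ) : ℂ) *
        expWeight g f₀ (lowered α (X.1.erase j)) lam z) (polyhedron g) := fun j _ =>
    (hint _ X.1 X.2 (Finset.erase_subset _ _)).const_mul _
  have h1 : ∫ z in polyhedron g, ((f₀ z - f₀ (vertexPoint f X) : ℝ) : ℂ) *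
      expWeight g f₀ (lowered α X.1) lam z =
      ∑ j ∈ X.1, ((s j / (f j).linear (edgeVector f f₀ (X.1.erase j)) : ℝ) : ℂ) *
        ∫ z in polyhedron g, expWeight g f₀ (lowered α (X.1.erase j)) lam z := by
    simp_rw [← integral_const_mul]
    rw [← integral_finsetSum _ hi]
    refine setIntegral_congr_fun hP fun z hz => ?_
    rw [form_eq_sum hf hN hf₀ X z, add_sub_cancel_left, Complex.ofReal_sum, Finset.sum_mul]
    refine Finset.sum_congr rfl fun j hj => ?_
    rw [← mul_expWeight_lowered f₀ α hj lam hz, hgf]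
    push_cast
    ring
  rw [h1, ← sum_swapVertex hf hN hf₀ α X, Finset.mul_sum]
  refine Finset.sum_congr rfl fun j hj => ?_
  set U := X.1.erase j with hUdef
  set e := edgeVector f f₀ U
  have hU : U.card + 1 = k := card_erase_add_one X hj
  have hjU : j ∉ U := Finset.notMem_erase j X.1
  obtain ⟨he, he1⟩ := edgeVector_spec hf hN hf₀ hU
  have hne : ∀ r ∉ U, (f r).linear e ≠ 0 := fun r hr =>
    linear_edgeVector_ne_zero hf hN hf₀ hU hr
  -- The case r = j is kept among the r ∉ U, since it yields the diagonal of B.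
  have hibp := integral_expWeight_lowered (g := g) (f₀ := f₀) (α := α) (U := U) (e := e)
    (lam := lam) (fun j hj => by rw [hglin, he j hj, mul_zero])
    (fun r hr => by rw [hglin]; exact mul_ne_zero (hs0 r) (hne r hr)) he1 (fun r _ => hα r)
    (hint _ X.1 X.2 (Finset.erase_subset _ _))
    (fun r hr => hint _ _ (by rw [Finset.card_insert_of_notMem hr, hU]) subset_rfl)
  have hcomm : ∀ a b c d : ℂ, a * b * (c * d) = b * c * (a * d) := fun a b c d => by ring
  rw [hcomm, hibp, Finset.mul_sum]
  refine Finset.sum_congr rfl fun r hr => ?_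
  rw [Finset.mem_compl] at hr
  have hY := swapVertex_val X hj hr
  rw [← hUdef] at hY
  rw [hY, ← mul_assoc, ← mul_assoc]
  congr 1
  norm_cast
  have hX : X.1 = insert j U := (Finset.insert_erase hj).symm
  have hvol := sign_mul_eq (hne j hjU) (volCoeff_insert f hr hX hY he (hne j hjU))
  rw [hX, Finset.prod_insert hjU, Finset.prod_insert hr, hglin, relSign]
  -- The sign `s j` occurs twice, once from the prefactor and once from f_j = s_j g_j, and cancels;
  -- `s r` completes the prefactor of the vertex U ∪ {r}.
  calc volCoeff f X * (s j * ∏ i ∈ U, s i) * (s j / (f j).linear e) * (α r * (s r * (f r).linear e))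
      = (s j * s j) * α r * (s r * ∏ i ∈ U, s i) *
          (volCoeff f X * ((f r).linear e / (f j).linear e)) := by ring
    _ = _ := by
      rw [hs, ← hvol]
      ring

end HyperplaneIntegrals

end

/-! ### The differential equation -/

open HyperplaneIntegrals MeasureTheory in
theorem mainTheorem7 {N k : ℕ} (hk : 1 ≤ k) (hN : k ≤ N)
    (o : Orientation ℝ (HyperplaneIntegrals.Space k) (Fin k))
    (f : Fin N → HyperplaneIntegrals.Space k →ᵃ[ℝ] ℝ)
    (hf : HyperplaneIntegrals.IsGeneric f)
    (α : Fin N → ℝ) (hα : ∀ j, 0 < α j)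
    (f₀ : HyperplaneIntegrals.Space k →ₗ[ℝ] ℝ)
    (hf₀ : HyperplaneIntegrals.IsGenericForm f f₀)
    (Δ : Set (HyperplaneIntegrals.Space k))
    (hΔ : Δ ∈ HyperplaneIntegrals.domainsPlus f f₀)
    (lam : ℂ) (hlam : 0 < lam.re) :
    (∀ X : HyperplaneIntegrals.Vertex N k,
      MeasureTheory.IntegrableOn (HyperplaneIntegrals.integrand o f f₀ α X lam) Δ) ∧
    HasDerivAt (HyperplaneIntegrals.integralVec o f f₀ α Δ)
      (-(((HyperplaneIntegrals.matA f f₀).map Complex.ofReal +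
          lam⁻¹ • (HyperplaneIntegrals.matB f f₀ α).map Complex.ofReal).mulVec
        (HyperplaneIntegrals.integralVec o f f₀ α Δ lam))) lam := by
  obtain ⟨hdom, hbdd⟩ := hΔ
  obtain ⟨s, hs, rfl, hne⟩ := exists_sign_of_mem_domains hdom
  set g : Fin N → Space k →ᵃ[ℝ] ℝ := fun j => s j • f j with hg
  have hP := (isOpen_polyhedron g).measurableSet
  have hlin : ∀ j v, (g j).linear v = 0 → (f j).linear v = 0 := fun j v h => by
    change s j * (f j).linear v = 0 at h
    rcases mul_eq_zero.1 h with h | h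
    · have := hs j
      rw [h, mul_zero] at this
      exact absurd this zero_ne_one
    · exact h
  have hgen : LinGeneric g := fun X hX v hv =>
    hf.linGeneric X hX v fun j hj => hlin j v (hv j hj)
  obtain ⟨c, K, hc, hgrow⟩ := exists_growth hgen hN (f₀ := f₀) (fun U hU v hv hfv => by
    obtain ⟨he, he1⟩ := edgeVector_spec hf hN hf₀ hU
    obtain ⟨t, rfl⟩ := hf.linGeneric.line hN hU he
      (fun h => by rw [h, map_zero] at he1; exact zero_ne_one he1) fun j hj => hlin j v (hv j hj)
    rw [map_smul, he1, smul_eq_mul, mul_one] at hfv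
    rw [hfv, zero_smul]) hne hbdd
  have hlow : ∀ S j, -1 < lowered α S j := fun S j => by
    have := hα j
    rw [lowered]
    split_ifs <;> linarith
  have hlow' : ∀ S X : Finset (Fin N), S ⊆ X → ∀ j ∉ X, 0 ≤ lowered α S j := fun S X hSX j hj => by
    rw [lowered, if_neg fun h => hj (hSX h)]
    exact (hα j).le
  have hint : ∀ S X : Finset (Fin N), X.card = k → S ⊆ X →
      IntegrableOn (expWeight g f₀ (lowered α S) lam) (polyhedron g) := fun S X hX hSX =>
    integrableOn_expWeight hgen hc hgrow hX (fun j _ => hlow S j) (hlow' S X hSX) hlam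
  have hvec : ∀ l : ℂ, ∀ X, integralVec o f f₀ α (polyhedron g) l X =
      ((volCoeff f X * ∏ j ∈ X.1, s j : ℝ) : ℂ) *
        ∫ z in polyhedron g, expWeight g f₀ (lowered α X.1) l z := fun l X => by
    rw [← integral_const_mul]
    exact setIntegral_congr_fun hP fun z hz => integrand_eq o f f₀ α X l hs hz
  refine ⟨fun X => IntegrableOn.congr_fun ((hint X.1 X.1 X.2 subset_rfl).const_mul _)
    (fun z hz => (integrand_eq o f f₀ α X lam hs hz).symm) hP, ?_⟩
  rw [hasDerivAt_pi]
  intro X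
  obtain ⟨hDint, hD⟩ := hasDerivAt_integral_expWeight hgen hc hgrow X.2
    (fun j _ => hlow X.1 j) (hlow' X.1 X.1 subset_rfl) hlam
  have hlam0 : lam ≠ 0 := fun h => by simp [h] at hlam
  have hmul := mul_integral_expWeight hf hN hf₀ hs hint hα X
  rw [← hg] at hmul
  simp_rw [← hvec lam] at hmul
  simp_rw [hvec _ X]
  refine (hD.const_mul _).congr_deriv ?_
  -- Separates the λ-derivative from the f₀(X) term, so that `hmul` can be solved for the derivative
  -- after division by λ.
  have hsub : ∫ z in polyhedron g, ((f₀ z - f₀ (vertexPoint f X) : ℝ) : ℂ) *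
      expWeight g f₀ (lowered α X.1) lam z =
      -(∫ z in polyhedron g, -(f₀ z : ℂ) * expWeight g f₀ (lowered α X.1) lam z) -
        (f₀ (vertexPoint f X) : ℂ) * ∫ z in polyhedron g, expWeight g f₀ (lowered α X.1) lam z := by
    have hDneg : IntegrableOn
        (fun z => -(-(f₀ z : ℂ) * expWeight g f₀ (lowered α X.1) lam z)) (polyhedron g) := hDint.neg
    rw [← integral_const_mul, ← integral_neg, ← integral_sub hDneg
      ((hint X.1 X.1 X.2 subset_rfl).const_mul _)]
    refine integral_congr_ae (Filter.Eventually.of_forall fun z => ?_)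
    push_cast
    ring
  rw [hsub] at hmul
  have hA : ((matA f f₀).map Complex.ofReal).mulVec
      (integralVec o f f₀ α (polyhedron g) lam) X =
      (f₀ (vertexPoint f X) : ℂ) * integralVec o f f₀ α (polyhedron g) lam X := by
    rw [matA, Matrix.diagonal_map Complex.ofReal_zero, Matrix.mulVec_diagonal]
  have hB : ((matB f f₀ α).map Complex.ofReal).mulVec
      (integralVec o f f₀ α (polyhedron g) lam) X =
      ∑ Y, (matB f f₀ α X Y : ℂ) * integralVec o f f₀ α (polyhedron g) lam Y := rfl
  rw [Pi.neg_apply, Matrix.add_mulVec, Matrix.smul_mulVec, Pi.add_apply, Pi.smul_apply, hA, hB,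
    ← hmul, hvec lam X, smul_eq_mul]
  field_simp
  ring
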